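/- For a square-integrable \(\Psi:\mathbb{R}^d\to\mathbb{C}\) (\(d\ge 1\)) with \(\|\Psi\|_2=1\) (a normalized wavefunction) let \(\widehat\Psi(x)=(2\pi)^{-d/2}\int_{\mathbb{R}^d}\Psi(u)e^{-i u\cdot x}\,du\) be its unitary Fourier transform (in the \(L^2\) sense). For \(\lambda>0\), define the Rényi entropy \(H_\lambda(\Psi)=\frac{2\lambda}{1-\lambda}\ln\|\Psi\|_{2\lambda}\) if \(\lambda\neq1\), the Shannon entropy \(H_1(\Psi)=-\int|\Psi|^2\ln|\Psi|^2\), and the entropy power \(N_\lambda(\Psi)=\exp(H_\lambda(\Psi)/d)\). Write \(N_\lambda(A)=N_\lambda(\Psi)\) and \(N_\lambda(\widetilde A)=N_\lambda(\widehat\Psi)\). Let \(\mathcal{D}_0=\{(\alpha,\beta)\in\mathbb{R}^2:\alpha>\tfrac12,\ \beta>\tfrac{\alpha}{2\alpha-1}\}\). **Theorem.** Let \(d\ge1\) and \((\alpha,\beta)\in\mathcal{D}_0\). Then for every \(\varepsilon>0\) there is a normalized wavefunction \(\Psi\) on \(\mathbb{R}^d\) for which \(H_\alpha(\Psi)\)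 and \(H_\beta(\widehat\Psi)\) are well defined and finite and \(0<N_\alpha(A)\,N_\beta(\widetilde A)<\varepsilon\). In other words, no entropic uncertainty relation holds in \(\mathcal{D}_0\): there is no constant \(C>0\) such that \(N_\alpha(A)N_\beta(\widetilde A)\ge C\) for all normalized wavefunctions for which both entropies are well defined and finite. The Student-\(t\) family is a witness. For every \(\nu>0\) the function \[\Psi_\nu(x)=\sqrt{\frac{\Gamma(\frac{d+\nu}{2})}{\pi^{d/2}\,\Gamma(\frac{\nu}{2})}}\;(1+|x|^2)^{-\frac{d+\nu}{4}}\] is a normalized wavefunction, and for almost every \(x\) \[\widehat{\Psi}_\nu(x)=\sqrt{\frac{2^{\frac{4-d-\nu}{2}}\,\Gamma(\frac{d+\nu}{2})}{\pi^{d/2}\,\Gamma(\frac{\nu}{2})\,\Gamma(\frac{d+\nu}{4})^2}}\;|x|^{\frac{\nu-d}{4}}\,K_{\frac{d-\nu}{4}}(|x|),\] where \(K_\mu\) is the modified Bessel function of the second kind. For every \(\nu>\max\bigl(0,\tfrac{d(\beta-1)}{\beta}\bigr)\) both \(H_\alpha(\Psi_\nu)\) and \(H_\beta(\widehat\Psi_\nu)\)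 are well defined and finite, and for every \(\varepsilon>0\) there is such a \(\nu\) with \(N_\alpha(\Psi_\nu)N_\beta(\widehat\Psi_\nu)<\varepsilon\). Moreover, \(N_\alpha(\Psi_\nu)N_\beta(\widehat\Psi_\nu)\to0\) as \(\nu\downarrow\frac{d(\beta-1)}{\beta}\) if \(\beta>1\), and as \(\nu\downarrow0\) if \(\beta<1\). -/

import Mathlib

open MeasureTheory Set Filter Topology
open scoped FourierTransform ENNReal

noncomputable section

namespace RenyiUncertainty

/-- The state space `ℝ^d` with its Euclidean norm and Lebesgue measure. -/
abbrev Space (d : ℕ) : Type := EuclideanSpace ℝ (Fin d)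

/-- A normalized wavefunction on `ℝ^d`: a square-integrable function with `L²`-norm `1`. -/
def IsWavefunction {d : ℕ} (ψ : Space d → ℂ) : Prop :=
  MemLp ψ 2 volume ∧ eLpNorm ψ 2 volume = 1

open Classical in
/-- The unitary Fourier transform of a square-integrable function,
`ψ̂(x) = (2π)^(-d/2) ∫ ψ(u) exp(-i ⟨u, x⟩) du`, extended to `L²` by Plancherel. Mathlib's `𝓕` on
`L²` extends `ξ ↦ ∫ ψ(u) exp(-2πi ⟨u, ξ⟩) du`, so it is evaluated at `x / (2π)` and rescaled.
The result is a representative, determined almost everywhere.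
The value for `ψ` outside `L²` is irrelevant. -/
def waveFourier {d : ℕ} (ψ : Space d → ℂ) : Space d → ℂ :=
  if h : MemLp ψ 2 volume then
    fun x => (((2 * Real.pi) ^ (-(d : ℝ) / 2) : ℝ) : ℂ) *
      (𝓕 (h.toLp ψ) : Lp (α := Space d) ℂ 2 volume) ((2 * Real.pi)⁻¹ • x)
  else 0

/-- The Rényi `λ`-entropy, for `λ > 0`: `2λ/(1-λ) ln ‖ψ‖_{2λ}` if `λ ≠ 1`, and the Shannon
entropy `-∫ |ψ|² ln |ψ|²` if `λ = 1`. -/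
def renyiEntropy {d : ℕ} (lam : ℝ) (ψ : Space d → ℂ) : ℝ :=
  if lam = 1 then -∫ x, ‖ψ x‖ ^ 2 * Real.log (‖ψ x‖ ^ 2)
  else 2 * lam / (1 - lam) * Real.log (eLpNorm ψ (ENNReal.ofReal (2 * lam)) volume).toReal

/-- The Rényi `λ`-entropy of `ψ` is well defined and finite: `0 < ‖ψ‖_{2λ} < ∞` if `λ ≠ 1`,
and `|ψ|² ln |ψ|²` is integrable if `λ = 1`. -/
def HasRenyiEntropy {d : ℕ} (lam : ℝ) (ψ : Space d → ℂ) : Prop :=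
  if lam = 1 then Integrable (fun x => ‖ψ x‖ ^ 2 * Real.log (‖ψ x‖ ^ 2)) volume
  else MemLp ψ (ENNReal.ofReal (2 * lam)) volume ∧
    eLpNorm ψ (ENNReal.ofReal (2 * lam)) volume ≠ 0

/-- The Rényi entropy power `N_λ = exp(H_λ / d)`. -/
def entropyPower {d : ℕ} (lam : ℝ) (ψ : Space d → ℂ) : ℝ :=
  Real.exp (1 / (d : ℝ) * renyiEntropy lam ψ)

/-- The set `𝒟₀` of pairs `(α, β)` with `α > 1/2` and `β > α / (2α - 1)`. -/
def domainD0 : Set (ℝ × ℝ) := {p | 1 / 2 < p.1 ∧ p.1 / (2 * p.1 - 1) < p.2}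

/-- The modified Bessel function of the second kind, for `r > 0`:
`K_μ(r) = ∫_0^∞ exp(-r cosh t) cosh(μ t) dt`. -/
def besselK (μ r : ℝ) : ℝ :=
  ∫ t in Ioi (0 : ℝ), Real.exp (-r * Real.cosh t) * Real.cosh (μ * t)

/-- The Student-t wavefunction on `ℝ^d` with `ν` degrees of freedom. -/
def studentT (d : ℕ) (ν : ℝ) (x : Space d) : ℂ :=
  ((Real.sqrt (Real.Gamma ((d + ν) / 2) / (Real.pi ^ ((d : ℝ) / 2) * Real.Gamma (ν / 2))) *
    (1 + ‖x‖ ^ 2) ^ (-(d + ν) / 4) : ℝ) : ℂ)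

/-- The closed form for the Fourier transform of the Student-t wavefunction. -/
def studentTHat (d : ℕ) (ν : ℝ) (x : Space d) : ℂ :=
  ((Real.sqrt (2 ^ ((4 - d - ν) / 2) * Real.Gamma ((d + ν) / 2) /
      (Real.pi ^ ((d : ℝ) / 2) * Real.Gamma (ν / 2) * Real.Gamma ((d + ν) / 4) ^ 2)) *
    (‖x‖ ^ 2) ^ ((ν - d) / 8) * besselK ((d - ν) / 4) ‖x‖ : ℝ) : ℂ)

end RenyiUncertainty

end

open RenyiUncertainty

/-!
The function `(1 + |x|²)^(-s)` is a superposition of Gaussians `exp(-t|x|²)` with Gamma weights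
`t^(s-1) exp(-t)`. Integrating out `x` gives the normalization of the Student-t functions.
Transforming each Gaussian gives their Fourier transform as a multiple of
`besselMix μ |x| = ∫_0^∞ t^(-μ-1) exp(-t - |x|²/(4t)) dt` with `μ = (d - ν)/4`, which the substitution
`t = (|x|/2) exp w` turns into the Bessel function `K_μ`. Since `studentT d ν` is not integrable for
`ν ≤ d`, the transform is identified by testing against Schwartz functions
(`integral_rpow_mul_fourier`, `waveFourier_studentT`), through the compatibility of the `L²` Fourier
transform with that of tempered distributions.

For `λ ≠ 1` the entropy is `(1 - λ)⁻¹ log ∫ |ψ|^(2λ)`, so everything rests on the size of these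
integrals. Both amplitudes squared are of order `ν` as `ν → 0` (`exists_studentAmp_bounds`), and
`besselMix μ r` is bounded above by `r^(-2μ) exp(-r/2)` and below, for `r ≤ 1`, by `r^(-2μ)`, up to
constants (`exists_besselMix_le`, `le_besselMix`).

* If `β > 1`, the momentum integral is at least a constant times `(ν - d(β-1)/β)⁻¹`, so the momentum
  entropy tends to `-∞` at `ν = d(β-1)/β`, where the position entropy stays bounded
  (`tendsto_renyiEntropy_studentTHat_atBot`, `exists_renyiEntropy_studentT_le`).
* If `β < 1`, then `α > 1`, and as `ν → 0` the sum of the entropies is at most a constant plus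
  `(β/(1-β) - α/(α-1)) log ν`, whose coefficient is positive exactly because `1/α + 1/β < 2`
  (`tendsto_renyiEntropy_add_atBot_of_lt_one`).
* The Shannon entropies are dominated by Rényi entropies of a slightly smaller order
  (`renyiEntropy_one_le`), for which the strict inequalities defining the domain still hold.
-/

noncomputable section

namespace RenyiUncertainty

/-! ### The Gaussian-mixture form of the Bessel function -/

/-- The Laplace-type integral `∫_0^∞ t^(-μ-1) exp(-t - r²/(4t)) dt = 2 (r/2)^(-μ) K_μ(r)`, the
form in which the Bessel function arises from a superposition of Gaussians. -/
def besselMix (μ r : ℝ) : ℝ :=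
  ∫ t in Ioi (0 : ℝ), t ^ (-μ - 1) * Real.exp (-t - r ^ 2 / (4 * t))

lemma exists_rpow_mul_exp_neg_half_le (M : ℝ) :
    ∃ C : ℝ, 0 < C ∧ ∀ a t : ℝ, 0 ≤ a → a ≤ M → 0 < t → t ^ a * Real.exp (-t / 2) ≤ C := by
  set n := ⌈M⌉₊
  refine ⟨1 + 2 ^ n * n.factorial, by positivity, fun a t ha haM ht => ?_⟩
  have hexp : Real.exp (-t / 2) ≤ 1 := Real.exp_le_one_iff.2 (by linarith)
  have h1 : t ^ a ≤ 1 + t ^ n := by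
    rcases le_total t 1 with h | h
    · exact (Real.rpow_le_one ht.le h ha).trans (by simp; positivity)
    · calc t ^ a ≤ t ^ (n : ℝ) :=
            Real.rpow_le_rpow_of_exponent_le h (haM.trans (Nat.le_ceil M))
        _ = t ^ n := Real.rpow_natCast _ _
        _ ≤ _ := by linarith
  have h2 : (t / 2) ^ n / n.factorial ≤ Real.exp (t / 2) :=
    Real.pow_div_factorial_le_exp (t / 2) (by positivity) n
  have h3 : t ^ n ≤ 2 ^ n * n.factorial * Real.exp (t / 2) := by
    rw [div_pow, div_div, div_le_iff₀ (by positivity)] at h2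
    linarith
  calc t ^ a * Real.exp (-t / 2) ≤ (1 + t ^ n) * Real.exp (-t / 2) := by gcongr
    _ = Real.exp (-t / 2) + t ^ n * Real.exp (-t / 2) := by ring
    _ ≤ 1 + (2 ^ n * n.factorial * Real.exp (t / 2)) * Real.exp (-t / 2) := by gcongr
    _ = _ := by rw [mul_assoc _ (Real.exp _), ← Real.exp_add]; ring_nf; simp

/-- Inverse-Gamma integral, obtained from Euler's integral by inverting the variable. -/
lemma inverseGamma_integral {μ b : ℝ} (hμ : 0 < μ) (hb : 0 < b) :
    IntegrableOn (fun t : ℝ => t ^ (-μ - 1) * Real.exp (-b / t)) (Ioi 0) ∧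
    ∫ t in Ioi (0 : ℝ), t ^ (-μ - 1) * Real.exp (-b / t) = b ^ (-μ) * Real.Gamma μ := by
  have key : ∀ x ∈ Ioi (0 : ℝ), (|(-1 : ℝ)| * x ^ ((-1 : ℝ) - 1)) •
      ((x ^ (-1 : ℝ)) ^ (μ - 1) * Real.exp (-(b * x ^ (-1 : ℝ)))) =
      x ^ (-μ - 1) * Real.exp (-b / x) := by
    intro x hx
    have hx : 0 < x := hx
    rw [← Real.rpow_mul hx.le, smul_eq_mul, abs_neg, abs_one, one_mul, ← mul_assoc,
      ← Real.rpow_add hx, Real.rpow_neg_one]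
    congr 2
    · ring
    · ring
  constructor
  · have h0 : IntegrableOn (fun y : ℝ => y ^ (μ - 1) * Real.exp (-(b * y))) (Ioi 0) := by
      have := integrableOn_rpow_mul_exp_neg_mul_rpow (p := 1) (s := μ - 1) (b := b)
        (by linarith) one_pos hb
      simpa using this
    have := (integrableOn_Ioi_comp_rpow_iff
      (fun y : ℝ => y ^ (μ - 1) * Real.exp (-(b * y))) (p := -1) (by norm_num)).2 h0
    exact this.congr_fun key measurableSet_Ioi
  · rw [← setIntegral_congr_fun measurableSet_Ioi key,
      integral_comp_rpow_Ioi (fun y : ℝ => y ^ (μ - 1) * Real.exp (-(b * y))) (by norm_num),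
      Real.integral_rpow_mul_exp_neg_mul_Ioi hμ hb, one_div, Real.inv_rpow hb.le,
      Real.rpow_neg hb.le]

lemma besselMix_integrand_nonneg (μ r : ℝ) {t : ℝ} (ht : 0 < t) :
    0 ≤ t ^ (-μ - 1) * Real.exp (-t - r ^ 2 / (4 * t)) := by positivity

lemma measurable_besselMix_integrand (μ : ℝ) :
    Measurable (fun z : ℝ × ℝ => z.2 ^ (-μ - 1) * Real.exp (-z.2 - z.1 ^ 2 / (4 * z.2))) := by
  fun_prop

lemma besselMix_nonneg (μ r : ℝ) : 0 ≤ besselMix μ r :=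
  setIntegral_nonneg measurableSet_Ioi fun _ ht => besselMix_integrand_nonneg μ r ht

lemma measurable_besselMix (μ : ℝ) : Measurable (besselMix μ) := by
  have := (measurable_besselMix_integrand μ).stronglyMeasurable
  exact (this.integral_prod_right (ν := volume.restrict (Ioi (0 : ℝ)))).measurable

/-- Half of `exp(-t)` and half of the Gaussian factor give `exp(-r/2)` by the inequality between
arithmetic and geometric means; the rest of `exp(-t)` pays for the change of exponent. -/
lemma besselMix_integrand_le {μ μ' C r t : ℝ} (ht : 0 < t)
    (hC : t ^ (μ' - μ) * Real.exp (-t / 2) ≤ C) :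
    t ^ (-μ - 1) * Real.exp (-t - r ^ 2 / (4 * t)) ≤
      C * Real.exp (-r / 2) * (t ^ (-μ' - 1) * Real.exp (-(r ^ 2 / 8) / t)) := by
  have e1 : t ^ (-μ - 1) = t ^ (μ' - μ) * t ^ (-μ' - 1) := by
    rw [← Real.rpow_add ht]; congr 1; ring
  have h2 : -t - r ^ 2 / (4 * t) ≤ -t / 2 + -r / 2 + -(r ^ 2 / 8) / t := by
    have : -t / 2 + -r / 2 + -(r ^ 2 / 8) / t - (-t - r ^ 2 / (4 * t)) =
        (t - r / 2) ^ 2 / (2 * t) := by field_simp; ring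
    have : 0 ≤ (t - r / 2) ^ 2 / (2 * t) := by positivity
    linarith
  calc t ^ (-μ - 1) * Real.exp (-t - r ^ 2 / (4 * t))
      ≤ t ^ (-μ - 1) * Real.exp (-t / 2 + -r / 2 + -(r ^ 2 / 8) / t) := by gcongr
    _ = (t ^ (μ' - μ) * Real.exp (-t / 2)) *
        (Real.exp (-r / 2) * (t ^ (-μ' - 1) * Real.exp (-(r ^ 2 / 8) / t))) := by
          rw [e1, Real.exp_add, Real.exp_add]; ring
    _ ≤ C * (Real.exp (-r / 2) * (t ^ (-μ' - 1) * Real.exp (-(r ^ 2 / 8) / t))) := by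
          gcongr
    _ = _ := by ring

lemma integrableOn_besselMix (μ : ℝ) {r : ℝ} (hr : 0 < r) :
    IntegrableOn (fun t : ℝ => t ^ (-μ - 1) * Real.exp (-t - r ^ 2 / (4 * t))) (Ioi 0) := by
  obtain ⟨C, -, hC⟩ := exists_rpow_mul_exp_neg_half_le (max μ 1 - μ)
  refine Integrable.mono'
    (((inverseGamma_integral (μ := max μ 1) (b := r ^ 2 / 8) (by simp)
      (by positivity)).1).const_mul (C * Real.exp (-r / 2))) ?_ ?_
  · exact Measurable.aestronglyMeasurable (by fun_prop)
  · refine (ae_restrict_mem measurableSet_Ioi).mono fun t ht => ?_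
    rw [Real.norm_of_nonneg (besselMix_integrand_nonneg μ r ht)]
    exact besselMix_integrand_le ht (hC _ t (by simp) le_rfl ht)

/-- The upper bound is uniform in `μ` as long as `μ' - μ` stays bounded. -/
lemma exists_besselMix_le {μ' : ℝ} (hμ' : 0 < μ') (M : ℝ) :
    ∃ C : ℝ, 0 < C ∧ ∀ μ r : ℝ, μ ≤ μ' → μ' - μ ≤ M → 0 < r →
      besselMix μ r ≤ C * (r ^ (-(2 * μ')) * Real.exp (-r / 2)) := by
  obtain ⟨C, hC0, hC⟩ := exists_rpow_mul_exp_neg_half_le M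
  refine ⟨C * (8 ^ μ' * Real.Gamma μ'),
    mul_pos hC0 (mul_pos (by positivity) (Real.Gamma_pos_of_pos hμ')), fun μ r h1 h2 hr => ?_⟩
  have hi := inverseGamma_integral hμ' (b := r ^ 2 / 8) (by positivity)
  calc besselMix μ r
      ≤ ∫ t in Ioi (0 : ℝ),
          C * Real.exp (-r / 2) * (t ^ (-μ' - 1) * Real.exp (-(r ^ 2 / 8) / t)) :=
        setIntegral_mono_on (integrableOn_besselMix μ hr) (hi.1.const_mul _) measurableSet_Ioi
          fun t ht => besselMix_integrand_le ht (hC _ t (by linarith) h2 ht)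
    _ = _ := by
        rw [integral_const_mul, hi.2, Real.div_rpow (by positivity) (by norm_num),
          Real.rpow_neg (by norm_num : (0 : ℝ) ≤ 8), ← Real.rpow_natCast r 2,
          ← Real.rpow_mul hr.le]
        push_cast
        rw [div_inv_eq_mul, show (2 : ℝ) * -μ' = -(2 * μ') by ring]
        ring

/-- Near the origin the mass of the integral comes from `t ∈ (r², 2r²)`. -/
lemma le_besselMix {μ r : ℝ} (hμ : -1 ≤ μ) (hr : 0 < r) (hr1 : r ≤ 1) :
    2 ^ (-μ - 1) * Real.exp (-9 / 4) * r ^ (-(2 * μ)) ≤ besselMix μ r := by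
  have hsub : Ioc (r ^ 2) (2 * r ^ 2) ⊆ Ioi (0 : ℝ) := fun t ht =>
    lt_trans (by positivity) ht.1
  have hI := integrableOn_besselMix μ hr
  have h1 : ∫ _ in Ioc (r ^ 2) (2 * r ^ 2), (2 * r ^ 2) ^ (-μ - 1) * Real.exp (-9 / 4) ≤
      ∫ t in Ioc (r ^ 2) (2 * r ^ 2), t ^ (-μ - 1) * Real.exp (-t - r ^ 2 / (4 * t)) := by
    refine setIntegral_mono_on (integrableOn_const (by simp)) (hI.mono_set hsub) measurableSet_Ioc fun t ht => ?_
    have ht0 : 0 < t := hsub ht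
    have hr2 : r ^ 2 ≤ 1 := pow_le_one₀ hr.le hr1
    have e1 : (2 * r ^ 2) ^ (-μ - 1) ≤ t ^ (-μ - 1) :=
      Real.rpow_le_rpow_of_nonpos ht0 ht.2 (by linarith)
    have e2 : -9 / 4 ≤ -t - r ^ 2 / (4 * t) := by
      have : r ^ 2 / (4 * t) ≤ 1 / 4 := by
        rw [div_le_div_iff₀ (by positivity) (by norm_num)]
        linarith [ht.1]
      linarith [ht.2]
    gcongr
  have h2 : ∫ t in Ioc (r ^ 2) (2 * r ^ 2), t ^ (-μ - 1) * Real.exp (-t - r ^ 2 / (4 * t)) ≤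
      besselMix μ r :=
    setIntegral_mono_set hI ((ae_restrict_mem measurableSet_Ioi).mono fun t ht =>
      besselMix_integrand_nonneg μ r ht) hsub.eventuallyLE
  refine le_trans (le_of_eq ?_) (h1.trans h2)
  rw [setIntegral_const, measureReal_def, Real.volume_Ioc, ENNReal.toReal_ofReal (by nlinarith),
    Real.mul_rpow (by norm_num) (by positivity), ← Real.rpow_natCast r 2, ← Real.rpow_mul hr.le,
    smul_eq_mul]
  have : r ^ (-(2 * μ)) = r ^ ((2 : ℕ) : ℝ) * r ^ (((2 : ℕ) : ℝ) * (-μ - 1)) := by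
    rw [← Real.rpow_add hr]; congr 1; push_cast; ring
  rw [this]; ring

/-- The substitution `t = (r/2) exp w`, followed by folding the two half-lines. -/
lemma besselMix_eq_besselK (μ : ℝ) {r : ℝ} (hr : 0 < r) :
    besselMix μ r = 2 * (r / 2) ^ (-μ) * besselK μ r := by
  set g : ℝ → ℝ := fun t => t ^ (-μ - 1) * Real.exp (-t - r ^ 2 / (4 * t)) with hg
  have himg : (fun w : ℝ => r / 2 * Real.exp w) '' univ = Ioi 0 := by
    ext t
    simp only [image_univ, mem_range, mem_Ioi]
    constructor
    · rintro ⟨w, rfl⟩; positivity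
    · intro ht
      refine ⟨Real.log (2 * t / r), ?_⟩
      rw [Real.exp_log (by positivity)]; field_simp
  have hder : ∀ w ∈ (univ : Set ℝ),
      HasDerivWithinAt (fun w : ℝ => r / 2 * Real.exp w) (r / 2 * Real.exp w) univ w :=
    fun w _ => ((Real.hasDerivAt_exp w).const_mul (r / 2)).hasDerivWithinAt
  have hinj : InjOn (fun w : ℝ => r / 2 * Real.exp w) univ := fun a _ b _ h =>
    Real.exp_injective (mul_left_cancel₀ (by positivity : r / 2 ≠ 0) h)
  have hval : ∀ w : ℝ, |r / 2 * Real.exp w| • g (r / 2 * Real.exp w) =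
      (r / 2) ^ (-μ) * (Real.exp (-μ * w) * Real.exp (-r * Real.cosh w)) := by
    intro w
    have hp : 0 < r / 2 * Real.exp w := by positivity
    rw [abs_of_pos hp, smul_eq_mul, hg]
    simp only
    rw [← mul_assoc]
    nth_rewrite 1 [← Real.rpow_one (r / 2 * Real.exp w)]
    rw [← Real.rpow_add hp, show 1 + (-μ - 1) = -μ by ring,
      Real.mul_rpow (by positivity) (by positivity), ← Real.exp_mul, mul_assoc, mul_comm w]
    congr 3
    rw [Real.cosh_eq, Real.exp_neg]
    field_simp
    ring
  have hint : Integrable (fun w : ℝ => Real.exp (-μ * w) * Real.exp (-r * Real.cosh w)) := by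
    have h := (integrableOn_image_iff_integrableOn_abs_deriv_smul MeasurableSet.univ hder hinj g).1
      (himg ▸ integrableOn_besselMix μ hr)
    simp_rw [hval, integrableOn_univ] at h
    have h' := h.const_mul ((r / 2) ^ (-μ))⁻¹
    refine h'.congr (Eventually.of_forall fun w => ?_)
    have : (r / 2) ^ (-μ) ≠ 0 := (Real.rpow_pos_of_pos (by positivity) _).ne'
    simp only
    rw [inv_mul_cancel_left₀ this]
  have h1 : besselMix μ r =
      (r / 2) ^ (-μ) * ∫ w : ℝ, Real.exp (-μ * w) * Real.exp (-r * Real.cosh w) := by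
    unfold besselMix
    rw [← himg, integral_image_eq_integral_abs_deriv_smul MeasurableSet.univ hder hinj g]
    simp_rw [hval, setIntegral_univ, integral_const_mul]
  have h2 : ∫ w : ℝ, Real.exp (-μ * w) * Real.exp (-r * Real.cosh w) = 2 * besselK μ r := by
    rw [← intervalIntegral.integral_Iic_add_Ioi (b := 0) hint.integrableOn hint.integrableOn]
    have h3 := integral_comp_neg_Ioi (0 : ℝ)
      (fun w : ℝ => Real.exp (-μ * w) * Real.exp (-r * Real.cosh w))
    rw [neg_zero] at h3
    rw [← h3, ← integral_add, besselK, ← integral_const_mul]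
    · congr 1; ext w
      simp only [Real.cosh_neg]
      rw [Real.cosh_eq (μ * w)]
      ring_nf
    · exact hint.comp_neg.integrableOn
    · exact hint.integrableOn
  rw [h1, h2]; ring

/-! ### Radial integrals -/

lemma integrable_rpow_neg_norm_mul_exp {d : ℕ} [NeZero d] {a b : ℝ} (ha : a < d) (hb : 0 < b) :
    Integrable (fun x : Space d => ‖x‖ ^ (-a) * Real.exp (-b * ‖x‖)) := by
  have h := (integrable_fun_norm_addHaar (volume : Measure (Space d))
    (f := fun y : ℝ => y ^ (-a) * Real.exp (-b * y))).2
  refine h ?_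
  have h0 := integrableOn_rpow_mul_exp_neg_mul_rpow (p := 1) (s := (d : ℝ) - 1 - a) (b := b)
    (by linarith) one_pos hb
  refine h0.congr_fun (fun y hy => ?_) measurableSet_Ioi
  have hy : 0 < y := hy
  have hd : 1 ≤ d := NeZero.one_le
  simp only [Real.rpow_one, finrank_euclideanSpace, Fintype.card_fin, smul_eq_mul]
  rw [← mul_assoc, ← Real.rpow_natCast, ← Real.rpow_add hy, Nat.cast_sub hd, Nat.cast_one,
    ← sub_eq_add_neg]

lemma integrable_besselMix_norm_rpow {d : ℕ} [NeZero d] {μ p : ℝ} (hp : 0 < p)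
    (hμ : 2 * μ * p < d) : Integrable (fun x : Space d => besselMix μ ‖x‖ ^ p) := by
  have hd : (0 : ℝ) < d := Nat.cast_pos.2 (NeZero.pos d)
  obtain ⟨μ', h0, h1, h2⟩ : ∃ μ' : ℝ, 0 < μ' ∧ μ ≤ μ' ∧ 2 * μ' * p < d := by
    rcases le_or_gt μ 0 with h | h
    · refine ⟨d / (4 * p), by positivity, h.trans (by positivity), ?_⟩
      have : 2 * (d / (4 * p)) * p = d / 2 := by field_simp; ring
      linarith
    · exact ⟨μ, h, le_rfl, hμ⟩
  obtain ⟨C, hC0, hC⟩ := exists_besselMix_le h0 (μ' - μ)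
  refine ((integrable_rpow_neg_norm_mul_exp (d := d) h2
    (by positivity : 0 < p / 2)).const_mul (C ^ p)).mono' ?_ ?_
  · exact (((measurable_besselMix μ).comp measurable_norm).pow_const p).aestronglyMeasurable
  · filter_upwards [compl_mem_ae_iff.2 (measure_singleton (0 : Space d))] with x hx
    have hx : 0 < ‖x‖ := norm_pos_iff.2 hx
    have hn := besselMix_nonneg μ ‖x‖
    rw [Real.norm_of_nonneg (by positivity)]
    calc besselMix μ ‖x‖ ^ p
        ≤ (C * (‖x‖ ^ (-(2 * μ')) * Real.exp (-‖x‖ / 2))) ^ p :=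
          Real.rpow_le_rpow hn (hC μ _ h1 le_rfl hx) hp.le
      _ = _ := by
          rw [Real.mul_rpow hC0.le (by positivity), Real.mul_rpow (by positivity) (by positivity),
            ← Real.rpow_mul hx.le, ← Real.exp_mul]
          ring_nf

/-! ### Superpositions of Gaussians -/

/-- Fubini for a nonnegative kernel whose total mass against `|g|` is finite. -/
lemma integral_kernel_mul_swap {d : ℕ} {k : Space d → ℝ → ℝ} {g : Space d → ℂ}
    (hm : Measurable (Function.uncurry k)) (h0 : ∀ x t, 0 < t → 0 ≤ k x t)
    (hk : ∀ᵐ x, IntegrableOn (k x) (Ioi 0)) (hg : AEStronglyMeasurable g)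
    (hI : Integrable fun x => ((∫ t in Ioi (0 : ℝ), k x t : ℝ) : ℂ) * g x) :
    ∫ x, ((∫ t in Ioi (0 : ℝ), k x t : ℝ) : ℂ) * g x =
      ∫ t in Ioi (0 : ℝ), ∫ x, (k x t : ℂ) * g x := by
  have hint : Integrable (Function.uncurry fun x t => (k x t : ℂ) * g x)
      ((volume : Measure (Space d)).prod (volume.restrict (Ioi (0 : ℝ)))) := by
    have hsm : AEStronglyMeasurable (Function.uncurry fun x t => (k x t : ℂ) * g x)
        ((volume : Measure (Space d)).prod (volume.restrict (Ioi (0 : ℝ)))) :=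
      (Complex.measurable_ofReal.comp hm).aestronglyMeasurable.mul hg.comp_fst
    rw [integrable_prod_iff hsm]
    refine ⟨hk.mono fun x hx => ?_, hI.norm.congr (Eventually.of_forall fun x => ?_)⟩
    · exact (Integrable.ofReal (𝕜 := ℂ) hx).mul_const (g x)
    · simp only [Function.uncurry_apply_pair, norm_mul, Complex.norm_real]
      rw [integral_mul_const, Real.norm_of_nonneg
        (setIntegral_nonneg measurableSet_Ioi fun t ht => h0 x t ht)]
      congr 1
      exact setIntegral_congr_fun measurableSet_Ioi fun t ht =>
        (Real.norm_of_nonneg (h0 x t ht)).symm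
  rw [← integral_integral_swap hint]
  refine integral_congr_ae (Eventually.of_forall fun x => ?_)
  simp only
  rw [integral_mul_const, integral_complex_ofReal]

lemma integral_gaussianKernel {s : ℝ} (hs : 0 < s) {r : ℝ} :
    ∫ t in Ioi (0 : ℝ), t ^ (s - 1) * Real.exp (-((1 + r ^ 2) * t)) =
      Real.Gamma s * (1 + r ^ 2) ^ (-s) := by
  rw [Real.integral_rpow_mul_exp_neg_mul_Ioi hs (by positivity), one_div,
    Real.inv_rpow (by positivity), Real.rpow_neg (by positivity), mul_comm]

lemma integrableOn_gaussianKernel {s : ℝ} (hs : 0 < s) {r : ℝ} :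
    IntegrableOn (fun t : ℝ => t ^ (s - 1) * Real.exp (-((1 + r ^ 2) * t))) (Ioi 0) := by
  have := integrableOn_rpow_mul_exp_neg_mul_rpow (p := 1) (s := s - 1) (b := 1 + r ^ 2)
    (by linarith) one_pos (by positivity)
  simpa only [Real.rpow_one, neg_mul] using this

/-- The power `(1 + |x|²)^(-s)` is a superposition of Gaussians with Gamma weights. -/
lemma gamma_mul_integral_rpow_mul {d : ℕ} {s : ℝ} (hs : 0 < s) {g : Space d → ℂ}
    (hg : AEStronglyMeasurable g)
    (hI : Integrable fun x : Space d => (((1 + ‖x‖ ^ 2) ^ (-s) : ℝ) : ℂ) * g x) :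
    (Real.Gamma s : ℂ) * ∫ x : Space d, (((1 + ‖x‖ ^ 2) ^ (-s) : ℝ) : ℂ) * g x =
      ∫ t in Ioi (0 : ℝ), ∫ x : Space d,
        ((t ^ (s - 1) * Real.exp (-((1 + ‖x‖ ^ 2) * t)) : ℝ) : ℂ) * g x := by
  rw [← integral_kernel_mul_swap (k := fun (x : Space d) t =>
    t ^ (s - 1) * Real.exp (-((1 + ‖x‖ ^ 2) * t)))]
  · simp_rw [integral_gaussianKernel hs, Complex.ofReal_mul, mul_assoc]
    rw [integral_const_mul]
  · unfold Function.uncurry; fun_prop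
  · intro x t ht; positivity
  · exact Eventually.of_forall fun x => integrableOn_gaussianKernel hs
  · exact hg
  · simp_rw [integral_gaussianKernel hs, Complex.ofReal_mul, mul_assoc]
    exact hI.const_mul _

lemma integral_one_add_norm_sq_rpow {d : ℕ} {s : ℝ} (hs : (d : ℝ) / 2 < s) :
    ∫ x : Space d, (1 + ‖x‖ ^ 2) ^ (-s) =
      Real.pi ^ ((d : ℝ) / 2) * Real.Gamma (s - d / 2) / Real.Gamma s := by
  have hs0 : 0 < s := lt_of_le_of_lt (by positivity) hs
  have hint : Integrable fun x : Space d => (1 + ‖x‖ ^ 2) ^ (-s) := by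
    have := integrable_rpow_neg_one_add_norm_sq (E := Space d) (μ := volume) (r := 2 * s)
      (by simp; linarith)
    convert this using 3; ring
  have h := gamma_mul_integral_rpow_mul (d := d) hs0 (g := fun _ => 1)
    aestronglyMeasurable_const (by simpa using Integrable.ofReal (𝕜 := ℂ) hint)
  simp only [mul_one, integral_complex_ofReal] at h
  norm_cast at h
  have h2 : ∀ t ∈ Ioi (0 : ℝ),
      ∫ x : Space d, t ^ (s - 1) * Real.exp (-((1 + ‖x‖ ^ 2) * t)) =
        Real.pi ^ ((d : ℝ) / 2) * (t ^ (s - d / 2 - 1) * Real.exp (-(1 * t))) := by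
    intro t ht
    have ht : 0 < t := ht
    have : ∀ x : Space d, t ^ (s - 1) * Real.exp (-((1 + ‖x‖ ^ 2) * t)) =
        t ^ (s - 1) * Real.exp (-(1 * t)) * Real.exp (-t * ‖x‖ ^ 2) := fun x => by
      rw [mul_assoc, ← Real.exp_add]; ring_nf
    simp_rw [this]
    rw [integral_const_mul, GaussianFourier.integral_rexp_neg_mul_sq_norm ht,
      Real.div_rpow Real.pi_nonneg ht.le, show s - d / 2 - 1 = (s - 1) - d / 2 by ring,
      Real.rpow_sub ht (s - 1)]
    simp only [finrank_euclideanSpace, Fintype.card_fin]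
    ring
  rw [setIntegral_congr_fun measurableSet_Ioi h2, integral_const_mul,
    Real.integral_rpow_mul_exp_neg_mul_Ioi (by linarith) one_pos] at h
  rw [eq_div_iff (Real.Gamma_pos_of_pos hs0).ne', mul_comm, h]
  simp

/-! ### The Student-t wavefunctions -/

/-- The normalizing constant of the Student-t wavefunction. -/
def studentAmp (d : ℕ) (ν : ℝ) : ℝ :=
  Real.sqrt (Real.Gamma ((d + ν) / 2) / (Real.pi ^ ((d : ℝ) / 2) * Real.Gamma (ν / 2)))

lemma studentAmp_sq_pos {d : ℕ} {ν : ℝ} (hν : 0 < ν) :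
    0 < Real.Gamma ((d + ν) / 2) / (Real.pi ^ ((d : ℝ) / 2) * Real.Gamma (ν / 2)) := by
  have h1 : 0 < Real.Gamma ((d + ν) / 2) := Real.Gamma_pos_of_pos (by positivity)
  have h2 : 0 < Real.Gamma (ν / 2) := Real.Gamma_pos_of_pos (by positivity)
  have := Real.pi_pos
  positivity

lemma studentAmp_pos {d : ℕ} {ν : ℝ} (hν : 0 < ν) : 0 < studentAmp d ν :=
  Real.sqrt_pos.2 (studentAmp_sq_pos hν)

lemma studentAmp_nonneg (d : ℕ) (ν : ℝ) : 0 ≤ studentAmp d ν := Real.sqrt_nonneg _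

lemma studentT_eq (d : ℕ) (ν : ℝ) (x : Space d) :
    studentT d ν x = ((studentAmp d ν * (1 + ‖x‖ ^ 2) ^ (-((d + ν) / 4)) : ℝ) : ℂ) := by
  rw [studentT, studentAmp, neg_div]

lemma norm_studentT {d : ℕ} {ν : ℝ} (x : Space d) :
    ‖studentT d ν x‖ = studentAmp d ν * (1 + ‖x‖ ^ 2) ^ (-((d + ν) / 4)) := by
  rw [studentT_eq, Complex.norm_real, Real.norm_of_nonneg]
  exact mul_nonneg (studentAmp_nonneg d ν) (by positivity)

lemma norm_studentT_rpow {d : ℕ} {ν : ℝ} (p : ℝ) (x : Space d) :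
    ‖studentT d ν x‖ ^ p = studentAmp d ν ^ p * (1 + ‖x‖ ^ 2) ^ (-(p * ((d + ν) / 4))) := by
  rw [norm_studentT, Real.mul_rpow (studentAmp_nonneg d ν) (by positivity),
    ← Real.rpow_mul (by positivity)]
  ring_nf

lemma measurable_studentT (d : ℕ) (ν : ℝ) : Measurable (studentT d ν) := by
  unfold studentT; fun_prop

lemma integrable_norm_studentT_rpow {d : ℕ} {ν p : ℝ} (hp : 2 * d < p * (d + ν)) :
    Integrable fun x : Space d => ‖studentT d ν x‖ ^ p := by
  simp_rw [norm_studentT_rpow]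
  have := integrable_rpow_neg_one_add_norm_sq (E := Space d) (μ := volume) (r := p * ((d + ν) / 2))
    (by simp; linarith)
  convert this.const_mul (studentAmp d ν ^ p) using 4
  ring

lemma isWavefunction_studentT {d : ℕ} {ν : ℝ} (hν : 0 < ν) : IsWavefunction (studentT d ν) := by
  have hi : Integrable fun x : Space d => ‖studentT d ν x‖ ^ (2 : ℝ) :=
    integrable_norm_studentT_rpow (by linarith)
  have hm : MemLp (studentT d ν) 2 volume := by
    rw [memLp_two_iff_integrable_sq_norm (measurable_studentT d ν).aestronglyMeasurable]
    simpa using hi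
  refine ⟨hm, ?_⟩
  have h1 : ∫ x : Space d, ‖studentT d ν x‖ ^ (2 : ℝ) = 1 := by
    have e : ∀ x : Space d, ‖studentT d ν x‖ ^ (2 : ℝ) =
        studentAmp d ν ^ 2 * (1 + ‖x‖ ^ 2) ^ (-((d + ν) / 2)) := fun x => by
      rw [norm_studentT_rpow, Real.rpow_two]; ring_nf
    simp_rw [e]
    have h2 : 0 < Real.Gamma ((d + ν) / 2) := Real.Gamma_pos_of_pos (by positivity)
    have h3 : 0 < Real.Gamma (ν / 2) := Real.Gamma_pos_of_pos (by positivity)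
    rw [integral_const_mul, integral_one_add_norm_sq_rpow (by linarith), studentAmp,
      Real.sq_sqrt (studentAmp_sq_pos hν).le, show (d + ν) / 2 - d / 2 = ν / 2 by ring]
    have := Real.pi_pos
    field_simp
  rw [hm.eLpNorm_eq_integral_rpow_norm (by norm_num) (by norm_num)]
  simp only [ENNReal.toReal_ofNat]
  rw [h1]; simp

/-! ### The Fourier transform -/

/-- The amplitude of the Fourier transform in front of the Gaussian-mixture integral. -/
def studentHatAmp (d : ℕ) (ν : ℝ) : ℝ :=
  studentAmp d ν * 2 ^ (-(d : ℝ) / 2) / Real.Gamma ((d + ν) / 4)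

lemma studentHatAmp_pos {d : ℕ} {ν : ℝ} (hν : 0 < ν) : 0 < studentHatAmp d ν := by
  have h2 : 0 < Real.Gamma ((d + ν) / 4) := Real.Gamma_pos_of_pos (by positivity)
  have := studentAmp_pos (d := d) hν
  unfold studentHatAmp; positivity

lemma studentTHat_eq {d : ℕ} {ν : ℝ} (hν : 0 < ν) {x : Space d} (hx : x ≠ 0) :
    studentTHat d ν x = ((studentHatAmp d ν * besselMix ((d - ν) / 4) ‖x‖ : ℝ) : ℂ) := by
  have hx : 0 < ‖x‖ := norm_pos_iff.2 hx
  have h2 : 0 < Real.Gamma ((d + ν) / 4) := Real.Gamma_pos_of_pos (by positivity)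
  have hA := studentAmp_sq_pos (d := d) hν
  rw [studentTHat, besselMix_eq_besselK _ hx, studentHatAmp]
  congr 1
  have e1 : Real.sqrt (2 ^ ((4 - d - ν) / 2) * Real.Gamma ((d + ν) / 2) /
      (Real.pi ^ ((d : ℝ) / 2) * Real.Gamma (ν / 2) * Real.Gamma ((d + ν) / 4) ^ 2)) =
      2 ^ ((4 - d - ν) / 4) * studentAmp d ν / Real.Gamma ((d + ν) / 4) := by
    rw [Real.sqrt_eq_iff_mul_self_eq_of_pos
      (by have := studentAmp_pos (d := d) hν; positivity)]
    have h3 : studentAmp d ν * studentAmp d ν =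
        Real.Gamma ((d + ν) / 2) / (Real.pi ^ ((d : ℝ) / 2) * Real.Gamma (ν / 2)) :=
      Real.mul_self_sqrt hA.le
    have h4 : (2 : ℝ) ^ ((4 - d - ν) / 2) = 2 ^ ((4 - d - ν) / 4) * 2 ^ ((4 - d - ν) / 4) := by
      rw [← Real.rpow_add two_pos]; ring_nf
    calc _ = (2 : ℝ) ^ ((4 - d - ν) / 4) * 2 ^ ((4 - d - ν) / 4) *
          (studentAmp d ν * studentAmp d ν) / Real.Gamma ((d + ν) / 4) ^ 2 := by ring
      _ = _ := by rw [h3, ← h4]; field_simp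
  have e2 : (‖x‖ ^ 2) ^ ((ν - d) / 8) = ‖x‖ ^ (-((d - ν) / 4)) := by
    rw [← Real.rpow_natCast ‖x‖ 2, ← Real.rpow_mul hx.le]
    congr 1; push_cast; ring
  have e3 : (2 : ℝ) ^ ((4 - d - ν) / 4) = 2 ^ (-(d : ℝ) / 2) * 2 * 2 ^ ((d - ν) / 4) := by
    rw [← Real.rpow_add_one two_ne_zero, ← Real.rpow_add two_pos]; ring_nf
  rw [e1, e2, e3, Real.div_rpow hx.le two_pos.le, Real.rpow_neg two_pos.le, div_inv_eq_mul]
  ring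

lemma integral_gaussian_mul_fourier {d : ℕ} {t : ℝ} (ht : 0 < t) (φ : SchwartzMap (Space d) ℂ) :
    ∫ u : Space d, ((Real.exp (-t * ‖u‖ ^ 2) : ℝ) : ℂ) * (𝓕 φ) u =
      (((Real.pi / t) ^ ((d : ℝ) / 2) : ℝ) : ℂ) *
        ∫ ξ : Space d, ((Real.exp (-(Real.pi ^ 2 * ‖ξ‖ ^ 2 / t)) : ℝ) : ℂ) * φ ξ := by
  have J : Integrable (fun w : Space d => Complex.exp (-(t : ℂ) * ‖w‖ ^ 2)) := by
    simpa using GaussianFourier.integrable_cexp_neg_mul_sq_norm_add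
      (b := (t : ℂ)) (by simpa using ht) 0 (0 : Space d)
  have h : ∫ ξ : Space d, 𝓕 (fun w : Space d => Complex.exp (-(t : ℂ) * ‖w‖ ^ 2)) ξ • φ ξ =
      ∫ u : Space d, Complex.exp (-(t : ℂ) * ‖u‖ ^ 2) • 𝓕 (φ : Space d → ℂ) u := by
    simpa using! (VectorFourier.integral_fourierIntegral_smul_eq_flip (L := innerₗ (Space d))
      Real.continuous_fourierChar continuous_inner J φ.integrable)
  rw [SchwartzMap.fourier_coe]
  simp only [smul_eq_mul] at h
  calc _ = ∫ u : Space d, Complex.exp (-(t : ℂ) * ‖u‖ ^ 2) * 𝓕 (φ : Space d → ℂ) u := by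
        congr 1; ext u; push_cast; rfl
    _ = _ := by
        rw [← h, ← integral_const_mul]
        congr 1; ext ξ
        rw [fourier_gaussian_innerProductSpace (by simpa using ht)]
        rw [Complex.ofReal_cpow (by positivity)]
        push_cast
        simp only [finrank_euclideanSpace, Fintype.card_fin]
        ring_nf

/-- The distributional form of the Fourier transform of `(1 + |u|²)^(-s)`: transform each Gaussian
of the superposition. No integrability of `(1 + |u|²)^(-s)` itself is needed. -/
lemma integral_rpow_mul_fourier {d : ℕ} [NeZero d] {s : ℝ} (hs : 0 < s)
    (φ : SchwartzMap (Space d) ℂ) :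
    (Real.Gamma s : ℂ) * ∫ u : Space d, (((1 + ‖u‖ ^ 2) ^ (-s) : ℝ) : ℂ) * (𝓕 φ) u =
      ((Real.pi ^ ((d : ℝ) / 2) : ℝ) : ℂ) *
        ∫ ξ : Space d, ((besselMix (d / 2 - s) (2 * Real.pi * ‖ξ‖) : ℝ) : ℂ) * φ ξ := by
  have hpi := Real.pi_pos
  have hI1 : Integrable fun u : Space d => (((1 + ‖u‖ ^ 2) ^ (-s) : ℝ) : ℂ) * (𝓕 φ) u := by
    refine (𝓕 φ).integrable.bdd_mul (c := 1) ?_ (Eventually.of_forall fun u => ?_)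
    · exact Measurable.aestronglyMeasurable (by fun_prop)
    · rw [Complex.norm_real, Real.norm_of_nonneg (by positivity)]
      exact Real.rpow_le_one_of_one_le_of_nonpos (by nlinarith [norm_nonneg u]) (by linarith)
  have hB : Integrable fun ξ : Space d => besselMix (d / 2 - s) (2 * Real.pi * ‖ξ‖) := by
    have := (integrable_besselMix_norm_rpow (d := d) (μ := d / 2 - s) one_pos
      (by linarith)).comp_smul (R := 2 * Real.pi) (by positivity)
    simpa [norm_smul, abs_of_pos hpi] using this
  have hI2 : Integrable fun ξ : Space d =>
      ((besselMix (d / 2 - s) (2 * Real.pi * ‖ξ‖) : ℝ) : ℂ) * φ ξ := by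
    obtain ⟨C, hC⟩ := φ.toBoundedContinuousFunction.bddAbove_range_norm_comp
    exact (Integrable.ofReal (𝕜 := ℂ) hB).mul_bdd (c := C) φ.continuous.aestronglyMeasurable
      (Eventually.of_forall fun ξ => hC ⟨ξ, rfl⟩)
  rw [gamma_mul_integral_rpow_mul hs (𝓕 φ).continuous.aestronglyMeasurable hI1]
  have h2 := integral_kernel_mul_swap (k := fun (ξ : Space d) t =>
      t ^ (-(d / 2 - s) - 1) * Real.exp (-t - (2 * Real.pi * ‖ξ‖) ^ 2 / (4 * t))) (g := φ)
    (by unfold Function.uncurry; fun_prop) (fun x t ht => by positivity)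
    (by
      filter_upwards [compl_mem_ae_iff.2 (measure_singleton (0 : Space d))] with x hx
      have hx : 0 < ‖x‖ := norm_pos_iff.2 hx
      exact integrableOn_besselMix _ (by positivity))
    φ.continuous.aestronglyMeasurable hI2
  unfold besselMix
  rw [h2, ← integral_const_mul]
  refine setIntegral_congr_fun measurableSet_Ioi fun t ht => ?_
  have ht : 0 < t := ht
  calc _ = ((t ^ (s - 1) * Real.exp (-t) : ℝ) : ℂ) *
        ∫ u : Space d, ((Real.exp (-t * ‖u‖ ^ 2) : ℝ) : ℂ) * (𝓕 φ) u := by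
        rw [← integral_const_mul]
        congr 1; ext u
        rw [← mul_assoc, ← Complex.ofReal_mul, mul_assoc (t ^ (s - 1)), ← Real.exp_add]
        ring_nf
    _ = _ := by
        rw [integral_gaussian_mul_fourier ht, ← mul_assoc, ← integral_const_mul,
          ← integral_const_mul]
        congr 1; ext ξ
        rw [← mul_assoc, ← mul_assoc, ← Complex.ofReal_mul, ← Complex.ofReal_mul,
          ← Complex.ofReal_mul]
        congr 2
        rw [Real.div_rpow hpi.le ht.le, show -((d : ℝ) / 2 - s) - 1 = (s - 1) - d / 2 by ring,
          Real.rpow_sub ht (s - 1), sub_eq_add_neg (-t), Real.exp_add,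
          show -((2 * Real.pi * ‖ξ‖) ^ 2 / (4 * t)) = -(Real.pi ^ 2 * ‖ξ‖ ^ 2 / t) by
            field_simp; ring]
        ring

lemma waveFourier_studentT {d : ℕ} [NeZero d] {ν : ℝ} (hν : 0 < ν) :
    waveFourier (studentT d ν) =ᵐ[volume] studentTHat d ν := by
  have hpi := Real.pi_pos
  have hd : (0 : ℝ) < d := Nat.cast_pos.2 (NeZero.pos d)
  have hm : MemLp (studentT d ν) 2 volume := (isWavefunction_studentT hν).1
  set F : Lp (α := Space d) ℂ 2 volume := 𝓕 (hm.toLp (studentT d ν)) with hF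
  set s : ℝ := (d + ν) / 4 with hs
  have hs0 : 0 < s := by positivity
  have hG0 : (Real.Gamma s : ℂ) ≠ 0 :=
    Complex.ofReal_ne_zero.2 (Real.Gamma_pos_of_pos hs0).ne'
  set κ : ℝ := studentAmp d ν * Real.pi ^ ((d : ℝ) / 2) / Real.Gamma s with hκ
  set G : Space d → ℂ := fun ξ => ((κ * besselMix (d / 2 - s) (2 * Real.pi * ‖ξ‖) : ℝ) : ℂ) with hG
  have hGint : Integrable G := by
    have := (integrable_besselMix_norm_rpow (d := d) (μ := d / 2 - s) one_pos
      (by linarith)).comp_smul (R := 2 * Real.pi) (by positivity)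
    have h2 : Integrable fun ξ : Space d => besselMix (d / 2 - s) (2 * Real.pi * ‖ξ‖) := by
      simpa [norm_smul, abs_of_pos hpi] using this
    exact Integrable.ofReal (𝕜 := ℂ) (h2.const_mul κ)
  have key : ∀ᵐ ξ : Space d, F ξ = G ξ := by
    refine ae_eq_of_integral_contDiff_smul_eq
      ((Lp.memLp F).locallyIntegrable (by norm_num)) hGint.locallyIntegrable fun g hg hgc => ?_
    have hgc' : HasCompactSupport fun x => (g x : ℂ) := hgc.comp_left (g := Complex.ofReal) rfl
    have hg' : ContDiff ℝ (⊤ : ℕ∞) fun x => (g x : ℂ) := Complex.ofRealCLM.contDiff.comp hg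
    set φ : SchwartzMap (Space d) ℂ := hgc'.toSchwartzMap hg' with hφ
    have hφv : ∀ x, φ x = (g x : ℂ) := fun x => rfl
    have h1 : Lp.toTemperedDistribution F φ =
        Lp.toTemperedDistribution (hm.toLp (studentT d ν)) (𝓕 φ) := by
      rw [hF, ← Lp.fourier_toTemperedDistribution_eq, TemperedDistribution.fourier_apply]
    rw [Lp.toTemperedDistribution_apply, Lp.toTemperedDistribution_apply] at h1
    have h2 : ∫ x, (𝓕 φ) x • (hm.toLp (studentT d ν)) x =
        (studentAmp d ν : ℂ) *
          ∫ u : Space d, (((1 + ‖u‖ ^ 2) ^ (-s) : ℝ) : ℂ) * (𝓕 φ) u := by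
      rw [← integral_const_mul]
      refine integral_congr_ae ?_
      filter_upwards [hm.coeFn_toLp] with x hx
      rw [hx, studentT_eq, smul_eq_mul]
      push_cast; ring
    have h3 := integral_rpow_mul_fourier (d := d) hs0 φ
    have h4 : ∫ x, g x • G x = (κ : ℂ) *
        ∫ ξ : Space d, ((besselMix (d / 2 - s) (2 * Real.pi * ‖ξ‖) : ℝ) : ℂ) * φ ξ := by
      rw [← integral_const_mul]
      congr 1; ext x
      rw [hφv, Complex.real_smul, hG]
      push_cast; ring
    calc ∫ x, g x • F x = ∫ x, φ x • F x := by
          congr 1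
      _ = ∫ x, g x • G x := by
          rw [h1, h2, h4, hκ, Complex.ofReal_div, Complex.ofReal_mul, div_mul_eq_mul_div,
            eq_div_iff hG0, mul_assoc, mul_comm _ (Real.Gamma s : ℂ), h3, mul_assoc]
  have key' := (Measure.quasiMeasurePreserving_smul (volume : Measure (Space d))
    (r := (2 * Real.pi)⁻¹) (by positivity)).ae key
  filter_upwards [key', compl_mem_ae_iff.2 (measure_singleton (0 : Space d))] with x hx hx0
  have hx0 : x ≠ 0 := hx0
  rw [waveFourier, dif_pos hm, studentTHat_eq hν hx0]
  rw [← hF, hx, hG]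
  rw [← Complex.ofReal_mul, norm_smul, Real.norm_of_nonneg (by positivity),
    mul_inv_cancel_left₀ (by positivity), show (d : ℝ) / 2 - s = (d - ν) / 4 by rw [hs]; ring,
    ← mul_assoc, studentHatAmp, ← hs, hκ, neg_div, Real.mul_rpow two_pos.le hpi.le,
    Real.rpow_neg hpi.le]
  congr 2
  have : Real.pi ^ ((d : ℝ) / 2) ≠ 0 := (Real.rpow_pos_of_pos hpi _).ne'
  field_simp

/-! ### Rényi and Shannon entropies -/

lemma renyiEntropy_congr {d : ℕ} {lam : ℝ} {ψ φ : Space d → ℂ} (h : ψ =ᵐ[volume] φ) :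
    renyiEntropy lam ψ = renyiEntropy lam φ := by
  unfold renyiEntropy
  rw [eLpNorm_congr_ae h, integral_congr_ae (g := fun x => ‖φ x‖ ^ 2 * Real.log (‖φ x‖ ^ 2))]
  exact h.mono fun x hx => by simp only [hx]

lemma hasRenyiEntropy_congr {d : ℕ} {lam : ℝ} {ψ φ : Space d → ℂ} (h : ψ =ᵐ[volume] φ) :
    HasRenyiEntropy lam ψ ↔ HasRenyiEntropy lam φ := by
  unfold HasRenyiEntropy
  rw [eLpNorm_congr_ae h, memLp_congr_ae h,
    integrable_congr (g := fun x => ‖φ x‖ ^ 2 * Real.log (‖φ x‖ ^ 2))]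
  exact h.mono fun x hx => by simp only [hx]

lemma eLpNorm_ofReal_eq {d : ℕ} {lam : ℝ} {ψ : Space d → ℂ} (hlam : 0 < lam)
    (hm : MemLp ψ (ENNReal.ofReal (2 * lam)) volume) :
    eLpNorm ψ (ENNReal.ofReal (2 * lam)) volume =
      ENNReal.ofReal ((∫ x, ‖ψ x‖ ^ (2 * lam)) ^ (2 * lam)⁻¹) := by
  have h0 : 0 < 2 * lam := by positivity
  rw [hm.eLpNorm_eq_integral_rpow_norm (by simpa using h0) ENNReal.ofReal_ne_top,
    ENNReal.toReal_ofReal h0.le]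

lemma memLp_ofReal {d : ℕ} {lam : ℝ} {ψ : Space d → ℂ} (hlam : 0 < lam)
    (hψ : AEStronglyMeasurable ψ) (hi : Integrable fun x => ‖ψ x‖ ^ (2 * lam)) :
    MemLp ψ (ENNReal.ofReal (2 * lam)) volume := by
  have h0 : 0 < 2 * lam := by positivity
  rw [← integrable_norm_rpow_iff hψ (by simpa using h0) ENNReal.ofReal_ne_top,
    ENNReal.toReal_ofReal h0.le]
  exact hi

lemma hasRenyiEntropy_of_ne_one {d : ℕ} {lam : ℝ} {ψ : Space d → ℂ} (hlam : 0 < lam)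
    (hlam1 : lam ≠ 1) (hψ : AEStronglyMeasurable ψ)
    (hi : Integrable fun x => ‖ψ x‖ ^ (2 * lam)) (hpos : 0 < ∫ x, ‖ψ x‖ ^ (2 * lam)) :
    HasRenyiEntropy lam ψ := by
  have hm := memLp_ofReal hlam hψ hi
  rw [HasRenyiEntropy, if_neg hlam1]
  refine ⟨hm, ?_⟩
  rw [eLpNorm_ofReal_eq hlam hm]
  simpa using Real.rpow_pos_of_pos hpos _

lemma renyiEntropy_of_ne_one {d : ℕ} {lam : ℝ} {ψ : Space d → ℂ} (hlam : 0 < lam)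
    (hlam1 : lam ≠ 1) (hψ : AEStronglyMeasurable ψ)
    (hi : Integrable fun x => ‖ψ x‖ ^ (2 * lam)) (hpos : 0 < ∫ x, ‖ψ x‖ ^ (2 * lam)) :
    renyiEntropy lam ψ = 1 / (1 - lam) * Real.log (∫ x, ‖ψ x‖ ^ (2 * lam)) := by
  rw [renyiEntropy, if_neg hlam1, eLpNorm_ofReal_eq hlam (memLp_ofReal hlam hψ hi),
    ENNReal.toReal_ofReal (by positivity), Real.log_rpow hpos]
  have : 1 - lam ≠ 0 := sub_ne_zero.2 hlam1.symm
  field_simp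

lemma abs_mul_log_le {y a b : ℝ} (hy : 0 ≤ y) (ha : a < 1) (hb : 1 < b) :
    |y * Real.log y| ≤ y ^ a / (1 - a) + y ^ b / (b - 1) := by
  rcases hy.eq_or_lt with rfl | hy
  · have h1 : 0 ≤ (0 : ℝ) ^ a := Real.rpow_nonneg le_rfl _
    have h2 : 0 ≤ (0 : ℝ) ^ b := Real.rpow_nonneg le_rfl _
    have h3 : 0 < 1 - a := by linarith
    have h4 : 0 < b - 1 := by linarith
    rw [zero_mul, abs_zero]; positivity
  · have e1 : y ^ a = y * y ^ (a - 1) := by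
      rw [mul_comm, ← Real.rpow_add_one hy.ne']; ring_nf
    have e2 : y ^ b = y * y ^ (b - 1) := by
      rw [mul_comm, ← Real.rpow_add_one hy.ne']; ring_nf
    have h1 : Real.log y ≤ y ^ (b - 1) / (b - 1) := Real.log_le_rpow_div hy.le (by linarith)
    have h2 : -Real.log y ≤ y ^ (a - 1) / (1 - a) := by
      have := Real.log_le_rpow_div (inv_nonneg.2 hy.le) (show 0 < 1 - a by linarith)
      rwa [Real.log_inv, Real.inv_rpow hy.le, ← Real.rpow_neg hy.le, neg_sub] at this
    have h3 : 0 ≤ y ^ (b - 1) / (b - 1) :=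
      div_nonneg (Real.rpow_nonneg hy.le _) (by linarith)
    have h4 : 0 ≤ y ^ (a - 1) / (1 - a) :=
      div_nonneg (Real.rpow_nonneg hy.le _) (by linarith)
    rw [abs_mul, abs_of_pos hy, e1, e2, mul_div_assoc, mul_div_assoc, ← mul_add]
    exact mul_le_mul_of_nonneg_left (abs_le.2 ⟨by linarith, by linarith⟩) hy.le

lemma integrable_shannon {d : ℕ} {a b : ℝ} {ψ : Space d → ℂ} (ha : a < 1) (hb : 1 < b)
    (hψ : AEStronglyMeasurable ψ) (hia : Integrable fun x => ‖ψ x‖ ^ (2 * a))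
    (hib : Integrable fun x => ‖ψ x‖ ^ (2 * b)) :
    Integrable fun x => ‖ψ x‖ ^ 2 * Real.log (‖ψ x‖ ^ 2) := by
  refine ((hia.div_const (1 - a)).add (hib.div_const (b - 1))).mono' ?_
    (Eventually.of_forall fun x => ?_)
  · exact ((hψ.norm.aemeasurable.pow_const 2).mul
      (Real.measurable_log.comp_aemeasurable (hψ.norm.aemeasurable.pow_const 2))).aestronglyMeasurable
  · have h := abs_mul_log_le (y := ‖ψ x‖ ^ 2) (by positivity) ha hb
    rw [← Real.rpow_natCast, ← Real.rpow_mul (norm_nonneg _), ← Real.rpow_mul (norm_nonneg _),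
      Nat.cast_ofNat] at h
    rw [← Real.rpow_natCast, Nat.cast_ofNat]
    exact h

/-- The Rényi entropies of a probability density decrease in the order: Jensen's inequality, in the
form of the tangent-line bound `log y ≤ y / m - 1 + log m` at `m = ∫ p ^ λ`. -/
lemma renyiEntropy_one_le {d : ℕ} {lam : ℝ} {ψ : Space d → ℂ} (hlam : 0 < lam) (hlam1 : lam < 1)
    (hψ : AEStronglyMeasurable ψ) (h2 : Integrable fun x => ‖ψ x‖ ^ 2)
    (h2one : ∫ x, ‖ψ x‖ ^ 2 = 1) (hS : HasRenyiEntropy 1 ψ)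
    (hi : Integrable fun x => ‖ψ x‖ ^ (2 * lam)) (hpos : 0 < ∫ x, ‖ψ x‖ ^ (2 * lam)) :
    renyiEntropy 1 ψ ≤ renyiEntropy lam ψ := by
  rw [renyiEntropy_of_ne_one hlam hlam1.ne hψ hi hpos, renyiEntropy, if_pos rfl]
  rw [HasRenyiEntropy, if_pos rfl] at hS
  set m := ∫ x, ‖ψ x‖ ^ (2 * lam) with hm
  have h1 : 0 < 1 - lam := by linarith
  have hpt : ∀ x, (lam - 1) * (‖ψ x‖ ^ 2 * Real.log (‖ψ x‖ ^ 2)) ≤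
      m⁻¹ * ‖ψ x‖ ^ (2 * lam) + (Real.log m - 1) * ‖ψ x‖ ^ 2 := by
    intro x
    rcases (norm_nonneg (ψ x)).eq_or_lt with h0 | h0
    · rw [← h0, Real.zero_rpow (by positivity)]; simp
    · set p := ‖ψ x‖ ^ 2 with hp
      have hp0 : 0 < p := by positivity
      have e : ‖ψ x‖ ^ (2 * lam) = p * p ^ (lam - 1) := by
        rw [← Real.rpow_one_add' hp0.le (by linarith), hp, ← Real.rpow_natCast,
          ← Real.rpow_mul (norm_nonneg _)]
        congr 1; push_cast; ring
      have hq : 0 < p ^ (lam - 1) := Real.rpow_pos_of_pos hp0 _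
      have hl := Real.log_le_sub_one_of_pos (div_pos hq hpos)
      rw [Real.log_div hq.ne' hpos.ne', Real.log_rpow hp0] at hl
      calc (lam - 1) * (p * Real.log p) = p * ((lam - 1) * Real.log p) := by ring
        _ ≤ p * (p ^ (lam - 1) / m - 1 + Real.log m) := by gcongr; linarith
        _ = _ := by rw [e]; ring
  have hle := integral_mono (hS.const_mul (lam - 1))
    ((hi.const_mul m⁻¹).add (h2.const_mul (Real.log m - 1))) hpt
  rw [integral_const_mul, integral_add' (hi.const_mul m⁻¹) (h2.const_mul (Real.log m - 1)),
    integral_const_mul, integral_const_mul, h2one, ← hm, inv_mul_cancel₀ hpos.ne'] at hle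
  rw [div_mul_eq_mul_div, le_div_iff₀ h1]
  linarith

/-- Plancherel's identity for the rescaled Fourier transform. -/
lemma integral_norm_sq_waveFourier {d : ℕ} {ψ : Space d → ℂ} (hψ : IsWavefunction ψ) :
    Integrable (fun x => ‖waveFourier ψ x‖ ^ 2) ∧ ∫ x, ‖waveFourier ψ x‖ ^ 2 = 1 := by
  obtain ⟨hm, h1⟩ := hψ
  have hpi := Real.pi_pos
  set F : Lp (α := Space d) ℂ 2 volume := 𝓕 (hm.toLp ψ) with hF
  have hn : ‖F‖ = 1 := by
    rw [hF, Lp.norm_fourier_eq, Lp.norm_toLp, h1, ENNReal.toReal_one]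
  have hFm : MemLp F 2 volume := Lp.memLp F
  have hFi : Integrable fun x => ‖F x‖ ^ 2 :=
    (memLp_two_iff_integrable_sq_norm hFm.1).1 hFm
  have hF1 : ∫ x, ‖F x‖ ^ 2 = 1 := by
    have hI0 : 0 ≤ ∫ x, ‖F x‖ ^ 2 := integral_nonneg fun x => by positivity
    rw [Lp.norm_def, hFm.eLpNorm_eq_integral_rpow_norm (by norm_num) (by norm_num),
      ENNReal.toReal_ofNat, ENNReal.toReal_ofReal (by positivity)] at hn
    simp only [Real.rpow_two] at hn
    rw [← Real.rpow_inv_rpow hI0 (two_ne_zero : (2 : ℝ) ≠ 0), hn, Real.one_rpow]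
  have e : ∀ x, ‖waveFourier ψ x‖ ^ 2 =
      (2 * Real.pi) ^ (-(d : ℝ)) * ‖F ((2 * Real.pi)⁻¹ • x)‖ ^ 2 := by
    intro x
    rw [waveFourier, dif_pos hm, norm_mul, mul_pow, Complex.norm_real,
      Real.norm_of_nonneg (by positivity), ← Real.rpow_natCast, ← Real.rpow_mul (by positivity)]
    congr 2
    push_cast; ring
  have hR : (2 * Real.pi)⁻¹ ≠ 0 := by positivity
  simp_rw [e]
  refine ⟨(hFi.comp_smul hR).const_mul _, ?_⟩
  rw [integral_const_mul, Measure.integral_comp_smul volume (fun x => ‖F x‖ ^ 2), hF1]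
  simp only [finrank_euclideanSpace, Fintype.card_fin, inv_pow, inv_inv, smul_eq_mul, mul_one]
  rw [abs_of_pos (by positivity), Real.rpow_neg (by positivity), Real.rpow_natCast,
    inv_mul_cancel₀ (by positivity)]

/-! ### Positivity and integrability of powers -/

lemma integral_pos_of_ae_pos {d : ℕ} {f : Space d → ℝ} (hi : Integrable f)
    (hf : ∀ᵐ x, 0 < f x) : 0 < ∫ x, f x := by
  have h0 : 0 ≤ᵐ[volume] f := hf.mono fun x hx => le_of_lt hx
  refine (integral_nonneg_of_ae h0).lt_of_ne fun h => ?_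
  have h1 := (integral_eq_zero_iff_of_nonneg_ae h0 hi).1 h.symm
  obtain ⟨x, hx1, hx2⟩ := (h1.and hf).exists
  simp only [Pi.zero_apply] at hx1
  exact hx2.ne' hx1

lemma besselMix_pos (μ : ℝ) {r : ℝ} (hr : 0 < r) : 0 < besselMix μ r := by
  refine (setIntegral_pos_iff_support_of_nonneg_ae
    ((ae_restrict_mem measurableSet_Ioi).mono fun t ht => besselMix_integrand_nonneg μ r ht)
    (integrableOn_besselMix μ hr)).2 ?_
  have : Ioi (0 : ℝ) ⊆
      Function.support (fun t : ℝ => t ^ (-μ - 1) * Real.exp (-t - r ^ 2 / (4 * t))) ∩ Ioi 0 :=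
    fun t ht => ⟨(mul_pos (Real.rpow_pos_of_pos ht _) (Real.exp_pos _)).ne', ht⟩
  exact lt_of_lt_of_le (by simp) (measure_mono this)

lemma ae_ne_zero {d : ℕ} [NeZero d] : ∀ᵐ x : Space d, x ≠ 0 :=
  compl_mem_ae_iff.2 (measure_singleton (0 : Space d))

lemma integral_norm_studentT_rpow_pos {d : ℕ} {ν p : ℝ} (hν : 0 < ν)
    (hp : 2 * d < p * (d + ν)) : 0 < ∫ x : Space d, ‖studentT d ν x‖ ^ p := by
  refine integral_pos_of_ae_pos (integrable_norm_studentT_rpow hp)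
    (Eventually.of_forall fun x => ?_)
  have := studentAmp_pos (d := d) hν
  rw [norm_studentT_rpow]; positivity

lemma aestronglyMeasurable_studentTHat {d : ℕ} [NeZero d] {ν : ℝ} (hν : 0 < ν) :
    AEStronglyMeasurable (studentTHat d ν) := by
  have : Measurable fun x : Space d =>
      ((studentHatAmp d ν * besselMix ((d - ν) / 4) ‖x‖ : ℝ) : ℂ) :=
    Complex.measurable_ofReal.comp
      (((measurable_besselMix _).comp measurable_norm).const_mul _)
  exact this.aestronglyMeasurable.congr (ae_ne_zero.mono fun x hx => (studentTHat_eq hν hx).symm)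

lemma norm_studentTHat_rpow {d : ℕ} {ν : ℝ} (hν : 0 < ν) (p : ℝ) {x : Space d} (hx : x ≠ 0) :
    ‖studentTHat d ν x‖ ^ p = studentHatAmp d ν ^ p * besselMix ((d - ν) / 4) ‖x‖ ^ p := by
  have h1 := studentHatAmp_pos (d := d) hν
  have h2 := besselMix_nonneg ((d - ν) / 4) ‖x‖
  rw [studentTHat_eq hν hx, Complex.norm_real, Real.norm_of_nonneg (mul_nonneg h1.le h2),
    Real.mul_rpow h1.le h2]

lemma integrable_norm_studentTHat_rpow {d : ℕ} [NeZero d] {ν p : ℝ} (hν : 0 < ν) (hp : 0 < p)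
    (h : p * (d - ν) < 2 * d) : Integrable fun x : Space d => ‖studentTHat d ν x‖ ^ p :=
  ((integrable_besselMix_norm_rpow (d := d) (μ := (d - ν) / 4) hp (by linarith)).const_mul
    (studentHatAmp d ν ^ p)).congr
    (ae_ne_zero.mono fun _ hx => (norm_studentTHat_rpow hν p hx).symm)

lemma integral_norm_studentTHat_rpow_pos {d : ℕ} [NeZero d] {ν p : ℝ} (hν : 0 < ν) (hp : 0 < p)
    (h : p * (d - ν) < 2 * d) : 0 < ∫ x : Space d, ‖studentTHat d ν x‖ ^ p := by
  refine integral_pos_of_ae_pos (integrable_norm_studentTHat_rpow hν hp h)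
    (ae_ne_zero.mono fun x hx => ?_)
  have h1 := studentHatAmp_pos (d := d) hν
  have h2 := besselMix_pos ((d - ν) / 4) (norm_pos_iff.2 hx)
  rw [norm_studentTHat_rpow hν p hx]; positivity

/-! ### Behaviour of the amplitudes -/

lemma exists_bounds_of_continuousOn {h : ℝ → ℝ} {M : ℝ} (hM : 0 ≤ M)
    (hc : ContinuousOn h (Icc 0 M)) (hpos : ∀ ν ∈ Icc 0 M, 0 < h ν) :
    ∃ k K : ℝ, 0 < k ∧ 0 < K ∧ ∀ ν ∈ Icc 0 M, k ≤ h ν ∧ h ν ≤ K := by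
  obtain ⟨a, ha, hmin⟩ := isCompact_Icc.exists_isMinOn (nonempty_Icc.2 hM) hc
  obtain ⟨b, hb, hmax⟩ := isCompact_Icc.exists_isMaxOn (nonempty_Icc.2 hM) hc
  exact ⟨h a, h b, hpos a ha, hpos b hb, fun ν hν => ⟨hmin hν, hmax hν⟩⟩

lemma continuousOn_Gamma_comp {g : ℝ → ℝ} {s : Set ℝ} (hg : Continuous g)
    (hpos : ∀ x ∈ s, 0 < g x) : ContinuousOn (fun x => Real.Gamma (g x)) s := fun x hx =>
  ((Real.differentiableAt_Gamma fun m => by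
    have := hpos x hx
    have h0 : (0 : ℝ) ≤ m := m.cast_nonneg
    linarith).continuousAt.comp hg.continuousAt).continuousWithinAt

/-- Both squared amplitudes vanish exactly to first order as `ν → 0`. -/
lemma exists_studentAmp_bounds (d : ℕ) [NeZero d] {M : ℝ} (hM : 0 < M) :
    ∃ k K : ℝ, 0 < k ∧ 0 < K ∧ ∀ ν : ℝ, 0 < ν → ν ≤ M →
      (k * ν ≤ studentAmp d ν ^ 2 ∧ studentAmp d ν ^ 2 ≤ K * ν) ∧
      (k * ν ≤ studentHatAmp d ν ^ 2 ∧ studentHatAmp d ν ^ 2 ≤ K * ν) := by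
  have hd : (0 : ℝ) < d := Nat.cast_pos.2 (NeZero.pos d)
  have hpi := Real.pi_pos
  set h : ℝ → ℝ := fun ν =>
    Real.Gamma ((d + ν) / 2) / (2 * Real.pi ^ ((d : ℝ) / 2) * Real.Gamma (ν / 2 + 1)) with hh
  set g : ℝ → ℝ := fun ν => (2 ^ (-(d : ℝ) / 2) / Real.Gamma ((d + ν) / 4)) ^ 2 with hg
  have p1 : ∀ ν ∈ Icc 0 M, 0 < Real.Gamma ((d + ν) / 2) := fun ν hν =>
    Real.Gamma_pos_of_pos (by linarith [hν.1])
  have p2 : ∀ ν ∈ Icc 0 M, 0 < Real.Gamma (ν / 2 + 1) := fun ν hν =>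
    Real.Gamma_pos_of_pos (by linarith [hν.1])
  have p3 : ∀ ν ∈ Icc 0 M, 0 < Real.Gamma ((d + ν) / 4) := fun ν hν =>
    Real.Gamma_pos_of_pos (by linarith [hν.1])
  have hc : ContinuousOn h (Icc 0 M) := by
    refine (continuousOn_Gamma_comp (by fun_prop) fun ν hν => by linarith [hν.1]).div
      (continuousOn_const.mul (continuousOn_Gamma_comp (by fun_prop)
        fun ν hν => by linarith [hν.1])) fun ν hν => ?_
    have := p2 ν hν
    positivity
  have hgc : ContinuousOn g (Icc 0 M) :=
    (continuousOn_const.div (continuousOn_Gamma_comp (by fun_prop)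
      fun ν hν => by linarith [hν.1]) fun ν hν => (p3 ν hν).ne').pow 2
  have hpos : ∀ ν ∈ Icc 0 M, 0 < h ν := fun ν hν => by
    have := p1 ν hν
    have := p2 ν hν
    simp only [hh]; positivity
  have hgpos : ∀ ν ∈ Icc 0 M, 0 < g ν := fun ν hν => by
    have := p3 ν hν
    simp only [hg]; positivity
  obtain ⟨k1, K1, hk1, hK1, h1⟩ := exists_bounds_of_continuousOn hM.le hc hpos
  obtain ⟨k2, K2, hk2, hK2, h2⟩ := exists_bounds_of_continuousOn hM.le
    (hc.mul hgc) fun ν hν => mul_pos (hpos ν hν) (hgpos ν hν)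
  refine ⟨min k1 k2, max K1 K2, lt_min hk1 hk2, lt_max_of_lt_left hK1, fun ν hν hνM => ?_⟩
  have hmem : ν ∈ Icc 0 M := ⟨hν.le, hνM⟩
  have e1 : studentAmp d ν ^ 2 = h ν * ν := by
    have := p2 ν hmem
    rw [studentAmp, Real.sq_sqrt (studentAmp_sq_pos hν).le, hh]
    simp only
    rw [Real.Gamma_add_one (by positivity)]
    field_simp
  have e2 : studentHatAmp d ν ^ 2 = h ν * g ν * ν := by
    rw [studentHatAmp, mul_div_assoc, mul_pow, e1]; ring
  have b1 := h1 ν hmem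
  have b2 := h2 ν hmem
  simp only [Pi.mul_apply] at b2
  rw [e1, e2]
  refine ⟨⟨?_, ?_⟩, ?_, ?_⟩
  · exact mul_le_mul_of_nonneg_right ((min_le_left _ _).trans b1.1) hν.le
  · exact mul_le_mul_of_nonneg_right (b1.2.trans (le_max_left _ _)) hν.le
  · exact mul_le_mul_of_nonneg_right ((min_le_right _ _).trans b2.1) hν.le
  · exact mul_le_mul_of_nonneg_right (b2.2.trans (le_max_right _ _)) hν.le

lemma rpow_two_mul {a : ℝ} (ha : 0 ≤ a) (p : ℝ) : a ^ (2 * p) = (a ^ 2) ^ p := by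
  rw [Real.rpow_mul ha, Real.rpow_two]

/-! ### Bounds for the integrals of powers -/

lemma exists_le_integral_studentT (d : ℕ) [NeZero d] {α M : ℝ} (hα : 0 < α) (hM : 0 < M) :
    ∃ k : ℝ, 0 < k ∧ ∀ ν : ℝ, 0 < ν → ν ≤ M → d < α * (d + ν) →
      k * ν ^ α ≤ ∫ x : Space d, ‖studentT d ν x‖ ^ (2 * α) := by
  obtain ⟨k, _, hk, _, hb⟩ := exists_studentAmp_bounds d hM
  set V := (volume : Measure (Space d)).real (Metric.ball 0 1) with hV
  have hV0 : 0 < V := ENNReal.toReal_pos (Metric.measure_ball_pos _ _ one_pos).ne'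
    measure_ball_lt_top.ne
  refine ⟨V * (k ^ α * 2 ^ (-(2 * α * ((d + M) / 4)))), by positivity, fun ν hν hνM hd => ?_⟩
  have hi : Integrable fun x : Space d => ‖studentT d ν x‖ ^ (2 * α) :=
    integrable_norm_studentT_rpow (by linarith)
  have hA : k ^ α * ν ^ α ≤ studentAmp d ν ^ (2 * α) := by
    rw [rpow_two_mul (studentAmp_nonneg d ν), ← Real.mul_rpow hk.le hν.le]
    exact Real.rpow_le_rpow (by positivity) (hb ν hν hνM).1.1 hα.le
  calc V * (k ^ α * 2 ^ (-(2 * α * ((d + M) / 4)))) * ν ^ α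
      = ∫ _ in Metric.ball (0 : Space d) 1,
          k ^ α * ν ^ α * 2 ^ (-(2 * α * ((d + M) / 4))) := by
        rw [setIntegral_const, smul_eq_mul]; ring
    _ ≤ ∫ x in Metric.ball (0 : Space d) 1, ‖studentT d ν x‖ ^ (2 * α) := by
        refine setIntegral_mono_on (integrableOn_const measure_ball_lt_top.ne) hi.integrableOn
          measurableSet_ball fun x hx => ?_
        have hx : ‖x‖ < 1 := mem_ball_zero_iff.1 hx
        rw [norm_studentT_rpow]
        refine mul_le_mul hA ?_ (by positivity) (Real.rpow_nonneg (studentAmp_nonneg d ν) _)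
        calc (2 : ℝ) ^ (-(2 * α * ((d + M) / 4))) ≤ 2 ^ (-(2 * α * ((d + ν) / 4))) :=
              Real.rpow_le_rpow_of_exponent_le one_le_two (by gcongr)
          _ ≤ _ := Real.rpow_le_rpow_of_nonpos (by positivity)
              (by nlinarith [norm_nonneg x]) (neg_nonpos.2 (by positivity))
    _ ≤ _ := setIntegral_le_integral hi (Eventually.of_forall fun x => by positivity)

lemma exists_integral_studentT_le (d : ℕ) [NeZero d] {α ν₀ M : ℝ} (hα : 0 < α) (hM : 0 < M)
    (hd : d < α * (d + ν₀)) :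
    ∃ K : ℝ, 0 < K ∧ ∀ ν : ℝ, 0 < ν → ν₀ ≤ ν → ν ≤ M →
      ∫ x : Space d, ‖studentT d ν x‖ ^ (2 * α) ≤ K := by
  obtain ⟨_, K, _, hK, hb⟩ := exists_studentAmp_bounds d hM
  have hi : Integrable fun x : Space d => (1 + ‖x‖ ^ 2) ^ (-(2 * α * ((d + ν₀) / 4))) := by
    have := integrable_rpow_neg_one_add_norm_sq (E := Space d) (μ := volume) (r := α * (d + ν₀))
      (by simpa using hd)
    convert this using 3
    ring
  have hI : 0 < ∫ x : Space d, (1 + ‖x‖ ^ 2) ^ (-(2 * α * ((d + ν₀) / 4))) :=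
    integral_pos_of_ae_pos hi (Eventually.of_forall fun x => by positivity)
  refine ⟨(K * M) ^ α * ∫ x : Space d, (1 + ‖x‖ ^ 2) ^ (-(2 * α * ((d + ν₀) / 4))),
    by positivity, fun ν hν hν₀ hνM => ?_⟩
  rw [← integral_const_mul]
  refine integral_mono_of_nonneg (Eventually.of_forall fun x => by positivity) (hi.const_mul _)
    (Eventually.of_forall fun x => ?_)
  simp only
  rw [norm_studentT_rpow, rpow_two_mul (studentAmp_nonneg d ν)]
  gcongr ?_ ^ α * ?_
  · exact (hb ν hν hνM).1.2.trans (by gcongr)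
  · exact Real.rpow_le_rpow_of_exponent_le (by nlinarith [norm_nonneg x]) (by gcongr)

lemma exists_integral_studentTHat_le (d : ℕ) [NeZero d] {β : ℝ} (hβ : 0 < β) (hβ1 : β < 1) :
    ∃ K : ℝ, 0 < K ∧ ∀ ν : ℝ, 0 < ν → ν ≤ d →
      ∫ x : Space d, ‖studentTHat d ν x‖ ^ (2 * β) ≤ K * ν ^ β := by
  have hd : (0 : ℝ) < d := Nat.cast_pos.2 (NeZero.pos d)
  obtain ⟨_, K, _, hK, hb⟩ := exists_studentAmp_bounds d hd
  -- the exponent `d / 4` is the limit of `(d - ν) / 4`, so that one bound serves all small `ν`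
  obtain ⟨C, hC, hCb⟩ := exists_besselMix_le (μ' := d / 4) (by positivity) (d / 4)
  have hi : Integrable fun x : Space d => ‖x‖ ^ (-(d * β)) * Real.exp (-β * ‖x‖) :=
    integrable_rpow_neg_norm_mul_exp (by nlinarith) hβ
  have hI : 0 < ∫ x : Space d, ‖x‖ ^ (-(d * β)) * Real.exp (-β * ‖x‖) :=
    integral_pos_of_ae_pos hi (ae_ne_zero.mono fun x hx => by
      have := norm_pos_iff.2 hx
      positivity)
  refine ⟨K ^ β * C ^ (2 * β) * ∫ x : Space d, ‖x‖ ^ (-(d * β)) * Real.exp (-β * ‖x‖),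
    by positivity, fun ν hν hνd => ?_⟩
  rw [mul_right_comm, ← integral_const_mul]
  refine integral_mono_of_nonneg (Eventually.of_forall fun x => by positivity) (hi.const_mul _)
    (ae_ne_zero.mono fun x hx => ?_)
  have hx0 := norm_pos_iff.2 hx
  have hJ := besselMix_nonneg ((d - ν) / 4) ‖x‖
  simp only
  rw [norm_studentTHat_rpow hν _ hx, rpow_two_mul (studentHatAmp_pos hν).le]
  calc (studentHatAmp d ν ^ 2) ^ β * besselMix ((d - ν) / 4) ‖x‖ ^ (2 * β)
      ≤ (K * ν) ^ β *
        (C * (‖x‖ ^ (-(2 * (d / 4 : ℝ))) * Real.exp (-‖x‖ / 2))) ^ (2 * β) := by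
        gcongr ?_ ^ β * ?_ ^ (2 * β)
        · exact (hb ν hν hνd).2.2
        · exact hCb _ _ (by linarith) (by linarith) hx0
    _ = _ := by
        rw [Real.mul_rpow hK.le hν.le, Real.mul_rpow hC.le (by positivity),
          Real.mul_rpow (by positivity) (by positivity), ← Real.rpow_mul hx0.le, ← Real.exp_mul]
        ring_nf

lemma setIntegral_ball_rpow_neg_norm {d : ℕ} [NeZero d] {a : ℝ} (ha : a < d) :
    IntegrableOn (fun x : Space d => ‖x‖ ^ (-a)) (Metric.ball 0 1) ∧
    ∫ x in Metric.ball (0 : Space d) 1, ‖x‖ ^ (-a) =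
      d * (volume : Measure (Space d)).real (Metric.ball 0 1) / (d - a) := by
  have hd : 1 ≤ d := NeZero.one_le
  have e : ∀ y ∈ Ioo (0 : ℝ) 1, y ^ ((d : ℝ) - 1 - a) = y ^ (d - 1) * y ^ (-a) := fun y hy => by
    rw [← Real.rpow_natCast, ← Real.rpow_add hy.1, Nat.cast_sub hd, Nat.cast_one, sub_eq_add_neg]
  have h0 : IntegrableOn (fun y : ℝ => y ^ ((d : ℝ) - 1 - a)) (Ioo 0 1) := by
    rw [intervalIntegral.integrableOn_Ioo_rpow_iff one_pos]; linarith
  constructor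
  · rw [integrableOn_fun_norm_addHaar (volume : Measure (Space d)) (f := fun y : ℝ => y ^ (-a))]
    refine h0.congr_fun (fun y hy => ?_) measurableSet_Ioo
    simpa using e y hy
  · have h1 : ∀ x : Space d, (Metric.ball (0 : Space d) 1).indicator (fun x => ‖x‖ ^ (-a)) x =
        (Iio (1 : ℝ)).indicator (fun y => y ^ (-a)) ‖x‖ := fun x => by simp [indicator]
    rw [← integral_indicator measurableSet_ball]
    simp_rw [h1]
    rw [integral_fun_norm_addHaar (volume : Measure (Space d))]
    have h2 : ∀ y : ℝ, y ^ (d - 1) * (Iio (1 : ℝ)).indicator (fun y => y ^ (-a)) y =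
        (Iio (1 : ℝ)).indicator (fun y => y ^ (d - 1) * y ^ (-a)) y := fun y => by
      by_cases hy : y < 1 <;> simp [hy]
    simp only [finrank_euclideanSpace, Fintype.card_fin, smul_eq_mul, nsmul_eq_mul]
    simp_rw [h2]
    rw [setIntegral_indicator measurableSet_Iio, Ioi_inter_Iio,
      ← setIntegral_congr_fun measurableSet_Ioo e, ← integral_Ioc_eq_integral_Ioo,
      ← intervalIntegral.integral_of_le zero_le_one, integral_rpow (Or.inl (by linarith)),
      Real.one_rpow, Real.zero_rpow (by linarith)]
    ring_nf

/-- At the critical `ν` the singularity of the Fourier transform at the origin ceases to have an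
integrable power, and the integral blows up. -/
lemma exists_le_integral_studentTHat (d : ℕ) [NeZero d] {β : ℝ} (hβ : 1 < β) :
    ∃ k : ℝ, 0 < k ∧ ∀ ν : ℝ, d * (β - 1) / β < ν → ν ≤ d →
      k / (ν - d * (β - 1) / β) ≤ ∫ x : Space d, ‖studentTHat d ν x‖ ^ (2 * β) := by
  have hd : (0 : ℝ) < d := Nat.cast_pos.2 (NeZero.pos d)
  have hβ0 : 0 < β := by linarith
  obtain ⟨k, _, hk, _, hb⟩ := exists_studentAmp_bounds d hd
  set V := (volume : Measure (Space d)).real (Metric.ball 0 1) with hV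
  have hV0 : 0 < V := ENNReal.toReal_pos (Metric.measure_ball_pos _ _ one_pos).ne'
    measure_ball_lt_top.ne
  set ν₀ : ℝ := d * (β - 1) / β with hν₀
  have hν₀0 : 0 < ν₀ := div_pos (mul_pos hd (by linarith)) hβ0
  set q : ℝ := (2 ^ (-(d : ℝ) / 4 - 1) * Real.exp (-9 / 4)) ^ (2 * β) with hq
  have hq0 : 0 < q := by positivity
  refine ⟨(k * ν₀) ^ β * q * (d * V / β), by positivity, fun ν hν hνd => ?_⟩
  have hν0 : 0 < ν := hν₀0.trans hν
  have hcrit : β * (d - ν) < d ∧ d - β * (d - ν) = β * (ν - ν₀) := by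
    have : β * ν₀ = d * (β - 1) := by rw [hν₀]; field_simp
    exact ⟨by nlinarith, by linarith⟩
  have hi : Integrable fun x : Space d => ‖studentTHat d ν x‖ ^ (2 * β) :=
    integrable_norm_studentTHat_rpow hν0 (by positivity) (by linarith [hcrit.1])
  obtain ⟨hB, hBv⟩ := setIntegral_ball_rpow_neg_norm (d := d) hcrit.1
  calc (k * ν₀) ^ β * q * (d * V / β) / (ν - ν₀)
      = ∫ x in Metric.ball (0 : Space d) 1, (k * ν₀) ^ β * q * ‖x‖ ^ (-(β * (d - ν))) := by
        rw [integral_const_mul, hBv, hcrit.2, ← hV]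
        field_simp
    _ ≤ ∫ x in Metric.ball (0 : Space d) 1, ‖studentTHat d ν x‖ ^ (2 * β) := by
        refine setIntegral_mono_on_ae (hB.const_mul _) hi.integrableOn measurableSet_ball
          (ae_ne_zero.mono fun x hx hx1 => ?_)
        have hx0 := norm_pos_iff.2 hx
        have hx1 : ‖x‖ < 1 := mem_ball_zero_iff.1 hx1
        rw [norm_studentTHat_rpow hν0 _ hx, rpow_two_mul (studentHatAmp_pos hν0).le, mul_assoc]
        gcongr ?_ ^ β * ?_
        · exact le_trans (by gcongr) (hb ν hν0 hνd).2.1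
        · calc q * ‖x‖ ^ (-(β * (d - ν)))
              = (2 ^ (-(d : ℝ) / 4 - 1) * Real.exp (-9 / 4) *
                  ‖x‖ ^ (-(2 * ((d - ν) / 4)))) ^ (2 * β) := by
                rw [Real.mul_rpow (by positivity) (by positivity), ← Real.rpow_mul hx0.le, ← hq]
                ring_nf
            _ ≤ _ := by
                gcongr
                refine le_trans ?_ (le_besselMix (μ := (d - ν) / 4) (by linarith) hx0 hx1.le)
                gcongr ?_ * _ * _
                exact Real.rpow_le_rpow_of_exponent_le one_le_two (by linarith)
    _ ≤ _ := setIntegral_le_integral hi (Eventually.of_forall fun x => by positivity)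

/-! ### Entropies of the Student-t wavefunctions -/

lemma mem_domainD0_iff {α β : ℝ} : (α, β) ∈ domainD0 ↔ 1 / 2 < α ∧ α + β < 2 * α * β := by
  simp only [domainD0, mem_ofPred_eq]
  refine and_congr_right fun h => ?_
  rw [div_lt_iff₀ (by linarith)]
  constructor <;> intro h' <;> linarith

lemma hasRenyiEntropy_studentT {d : ℕ} [NeZero d] {α ν : ℝ} (hα : 0 < α) (hν : 0 < ν)
    (h : d < α * (d + ν)) : HasRenyiEntropy α (studentT d ν) := by
  have hd : (0 : ℝ) < d := Nat.cast_pos.2 (NeZero.pos d)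
  have hm := (measurable_studentT d ν).aestronglyMeasurable (μ := volume)
  by_cases h1 : α = 1
  · subst h1
    rw [HasRenyiEntropy, if_pos rfl]
    refine integrable_shannon (a := (d + ν / 2) / (d + ν)) (b := 2) ?_ one_lt_two hm
      (integrable_norm_studentT_rpow ?_) (integrable_norm_studentT_rpow (by linarith))
    · rw [div_lt_one (by positivity)]; linarith
    · rw [mul_assoc, div_mul_cancel₀ _ (by positivity)]; linarith
  · exact hasRenyiEntropy_of_ne_one hα h1 hm (integrable_norm_studentT_rpow (by linarith))
      (integral_norm_studentT_rpow_pos hν (by linarith))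

lemma hasRenyiEntropy_studentTHat {d : ℕ} [NeZero d] {β ν : ℝ} (hβ : 0 < β) (hν : 0 < ν)
    (h : β * (d - ν) < d) : HasRenyiEntropy β (studentTHat d ν) := by
  have hd : (0 : ℝ) < d := Nat.cast_pos.2 (NeZero.pos d)
  have hm := aestronglyMeasurable_studentTHat (d := d) hν
  by_cases h1 : β = 1
  · subst h1
    rw [HasRenyiEntropy, if_pos rfl]
    have hδ : 0 < ν / (2 * d) := by positivity
    have hδd : ν / (2 * d) * d = ν / 2 := by field_simp
    refine integrable_shannon (a := 1 / 2) (b := 1 + ν / (2 * d)) (by norm_num) (by linarith) hm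
      (integrable_norm_studentTHat_rpow hν (by norm_num) (by linarith))
      (integrable_norm_studentTHat_rpow hν (by positivity) ?_)
    nlinarith [mul_pos hδ hν]
  · exact hasRenyiEntropy_of_ne_one hβ h1 hm
      (integrable_norm_studentTHat_rpow hν (by positivity) (by linarith))
      (integral_norm_studentTHat_rpow_pos hν (by positivity) (by linarith))

lemma renyiEntropy_studentT {d : ℕ} {α ν : ℝ} (hα : 0 < α) (hα1 : α ≠ 1) (hν : 0 < ν)
    (h : d < α * (d + ν)) : renyiEntropy α (studentT d ν) =
      1 / (1 - α) * Real.log (∫ x : Space d, ‖studentT d ν x‖ ^ (2 * α)) :=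
  renyiEntropy_of_ne_one hα hα1 (measurable_studentT d ν).aestronglyMeasurable
    (integrable_norm_studentT_rpow (by linarith))
    (integral_norm_studentT_rpow_pos hν (by linarith))

lemma renyiEntropy_studentTHat {d : ℕ} [NeZero d] {β ν : ℝ} (hβ : 0 < β) (hβ1 : β ≠ 1)
    (hν : 0 < ν) (h : β * (d - ν) < d) : renyiEntropy β (studentTHat d ν) =
      1 / (1 - β) * Real.log (∫ x : Space d, ‖studentTHat d ν x‖ ^ (2 * β)) :=
  renyiEntropy_of_ne_one hβ hβ1 (aestronglyMeasurable_studentTHat hν)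
    (integrable_norm_studentTHat_rpow hν (by positivity) (by linarith))
    (integral_norm_studentTHat_rpow_pos hν (by positivity) (by linarith))

lemma integral_norm_sq_studentT {d : ℕ} {ν : ℝ} (hν : 0 < ν) :
    Integrable (fun x => ‖studentT d ν x‖ ^ 2) ∧ ∫ x, ‖studentT d ν x‖ ^ 2 = 1 := by
  obtain ⟨hm, h1⟩ := isWavefunction_studentT (d := d) hν
  have hi := (memLp_two_iff_integrable_sq_norm hm.1).1 hm
  refine ⟨hi, ?_⟩
  have h0 : 0 ≤ ∫ x, ‖studentT d ν x‖ ^ 2 := integral_nonneg fun x => by positivity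
  rw [hm.eLpNorm_eq_integral_rpow_norm (by norm_num) (by norm_num), ENNReal.toReal_ofNat,
    ENNReal.ofReal_eq_one] at h1
  simp only [Real.rpow_two] at h1
  rw [← Real.rpow_inv_rpow h0 (two_ne_zero : (2 : ℝ) ≠ 0), h1, Real.one_rpow]

lemma renyiEntropy_one_studentT_le {d : ℕ} [NeZero d] {α ν : ℝ} (hα : 0 < α) (hα1 : α < 1)
    (hν : 0 < ν) (h : d < α * (d + ν)) :
    renyiEntropy 1 (studentT d ν) ≤ renyiEntropy α (studentT d ν) := by
  obtain ⟨h2, h21⟩ := integral_norm_sq_studentT (d := d) hν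
  exact renyiEntropy_one_le hα hα1 (measurable_studentT d ν).aestronglyMeasurable h2 h21
    (hasRenyiEntropy_studentT one_pos hν (by linarith))
    (integrable_norm_studentT_rpow (by linarith))
    (integral_norm_studentT_rpow_pos hν (by linarith))

lemma renyiEntropy_one_studentTHat_le {d : ℕ} [NeZero d] {β ν : ℝ} (hβ : 0 < β) (hβ1 : β < 1)
    (hν : 0 < ν) :
    renyiEntropy 1 (studentTHat d ν) ≤ renyiEntropy β (studentTHat d ν) := by
  have hd : (0 : ℝ) < d := Nat.cast_pos.2 (NeZero.pos d)
  obtain ⟨h2, h21⟩ := integral_norm_sq_waveFourier (isWavefunction_studentT (d := d) hν)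
  have hae : (fun x => ‖waveFourier (studentT d ν) x‖ ^ 2) =ᵐ[volume]
      fun x => ‖studentTHat d ν x‖ ^ 2 :=
    (waveFourier_studentT hν).mono fun x hx => by simp only [hx]
  have hlt : β * (d - ν) < d := by nlinarith [mul_pos hβ hν]
  exact renyiEntropy_one_le hβ hβ1 (aestronglyMeasurable_studentTHat hν) (h2.congr hae)
    ((integral_congr_ae hae).symm.trans h21)
    (hasRenyiEntropy_studentTHat one_pos hν (by linarith))
    (integrable_norm_studentTHat_rpow hν (by positivity) (by linarith))
    (integral_norm_studentTHat_rpow_pos hν (by positivity) (by linarith))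

/-! ### Asymptotics of the entropies -/

/-- Away from `ν = 0` and above the integrability threshold, the position entropy stays bounded. -/
lemma exists_renyiEntropy_studentT_le (d : ℕ) [NeZero d] {α ν₀ M : ℝ} (hα : 0 < α) (hM : 0 < M)
    (hν₀ : 0 < ν₀) (h : d < α * (d + ν₀)) :
    ∃ B : ℝ, ∀ ν : ℝ, ν₀ ≤ ν → ν ≤ M → renyiEntropy α (studentT d ν) ≤ B := by
  have hd : (0 : ℝ) < d := Nat.cast_pos.2 (NeZero.pos d)
  have hlt : ∀ {a ν : ℝ}, 0 < a → d < a * (d + ν₀) → ν₀ ≤ ν → d < a * (d + ν) :=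
    fun ha h hν => h.trans_le (by gcongr)
  have below : ∀ a : ℝ, 0 < a → a < 1 → d < a * (d + ν₀) →
      ∃ B : ℝ, ∀ ν : ℝ, ν₀ ≤ ν → ν ≤ M → renyiEntropy a (studentT d ν) ≤ B := by
    intro a ha ha1 had
    obtain ⟨K, -, hK⟩ := exists_integral_studentT_le d ha hM had
    refine ⟨1 / (1 - a) * Real.log K, fun ν hν hνM => ?_⟩
    have hν0 : 0 < ν := hν₀.trans_le hν
    have h1 : 0 < 1 - a := by linarith
    have h2 := hlt ha had hν
    rw [renyiEntropy_studentT ha ha1.ne hν0 h2]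
    have := integral_norm_studentT_rpow_pos (d := d) (p := 2 * a) hν0 (by linarith)
    gcongr
    exact hK ν hν0 hν hνM
  rcases lt_trichotomy α 1 with h1 | rfl | h1
  · exact below α hα h1 h
  · have ha0 : 0 < (d + ν₀ / 2) / (d + ν₀) := by positivity
    have ha1 : (d + ν₀ / 2) / (d + ν₀) < 1 := by
      rw [div_lt_one (by positivity)]; linarith
    have had : d < (d + ν₀ / 2) / (d + ν₀) * (d + ν₀) := by
      rw [div_mul_cancel₀ _ (by positivity)]; linarith
    obtain ⟨B, hB⟩ := below _ ha0 ha1 had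
    exact ⟨B, fun ν hν hνM => (renyiEntropy_one_studentT_le ha0 ha1 (hν₀.trans_le hν)
      (hlt ha0 had hν)).trans (hB ν hν hνM)⟩
  · obtain ⟨k, hk, hkb⟩ := exists_le_integral_studentT d hα hM
    refine ⟨1 / (1 - α) * Real.log (k * ν₀ ^ α), fun ν hν hνM => ?_⟩
    have hν0 : 0 < ν := hν₀.trans_le hν
    have h2 := hlt hα h hν
    rw [renyiEntropy_studentT hα h1.ne' hν0 h2]
    refine mul_le_mul_of_nonpos_left (Real.log_le_log (by positivity) ?_)
      (one_div_nonpos.2 (by linarith))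
    exact le_trans (by gcongr) (hkb ν hν0 hνM h2)

lemma tendsto_renyiEntropy_studentTHat_atBot (d : ℕ) [NeZero d] {β : ℝ} (hβ : 1 < β) :
    Tendsto (fun ν => renyiEntropy β (studentTHat d ν)) (𝓝[>] (d * (β - 1) / β)) atBot := by
  have hd : (0 : ℝ) < d := Nat.cast_pos.2 (NeZero.pos d)
  have hβ0 : 0 < β := by linarith
  obtain ⟨k, hk, hkb⟩ := exists_le_integral_studentTHat d hβ
  set ν₀ : ℝ := d * (β - 1) / β with hν₀
  have hν₀0 : 0 < ν₀ := div_pos (mul_pos hd (by linarith)) hβ0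
  have hβν : β * ν₀ = d * (β - 1) := by rw [hν₀]; field_simp
  have hν₀d : ν₀ < d := by nlinarith
  have h1 : Tendsto (fun ν => k / (ν - ν₀)) (𝓝[>] ν₀) atTop := by
    have : Tendsto (fun ν => ν - ν₀) (𝓝[>] ν₀) (𝓝[>] 0) := by
      refine tendsto_nhdsWithin_iff.2 ⟨?_, ?_⟩
      · have : Tendsto (fun ν : ℝ => ν - ν₀) (𝓝 ν₀) (𝓝 (ν₀ - ν₀)) :=
          (continuous_id.sub continuous_const).tendsto _
        rw [sub_self] at this
        exact this.mono_left nhdsWithin_le_nhds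
      · filter_upwards [self_mem_nhdsWithin] with ν hν
        exact mem_Ioi.2 (sub_pos.2 (mem_Ioi.1 hν))
    exact (tendsto_inv_nhdsGT_zero.comp this).const_mul_atTop hk
  have h2 : Tendsto (fun ν => 1 / (1 - β) * Real.log (k / (ν - ν₀))) (𝓝[>] ν₀) atBot :=
    (Real.tendsto_log_atTop.comp h1).const_mul_atTop_of_neg (one_div_neg.2 (by linarith))
  refine tendsto_atBot_mono' _ ?_ h2
  filter_upwards [self_mem_nhdsWithin, Ioo_mem_nhdsGT hν₀d] with ν hν hν'
  have hν : ν₀ < ν := hν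
  rw [renyiEntropy_studentTHat hβ0 hβ.ne' (hν₀0.trans hν) (by nlinarith)]
  exact mul_le_mul_of_nonpos_left (Real.log_le_log (div_pos hk (sub_pos.2 hν))
    (hkb ν hν hν'.2.le)) (one_div_nonpos.2 (by linarith))

/-- For `β < 1` both integrals scale like powers of `ν`, and the condition defining the domain says
that the resulting exponent `β / (1 - β) - α / (α - 1)` is positive. -/
lemma tendsto_renyiEntropy_add_atBot_of_lt_one (d : ℕ) [NeZero d] {α β : ℝ}
    (h : (α, β) ∈ domainD0) (hβ1 : β < 1) :
    Tendsto (fun ν => renyiEntropy α (studentT d ν) + renyiEntropy β (studentTHat d ν))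
      (𝓝[>] 0) atBot := by
  have hd : (0 : ℝ) < d := Nat.cast_pos.2 (NeZero.pos d)
  obtain ⟨hα2, hαβ⟩ := mem_domainD0_iff.1 h
  have hβ0 : 0 < β := by nlinarith
  have hα1 : 1 < α := by nlinarith
  have hα0 : 0 < α := by linarith
  obtain ⟨k, hk, hkb⟩ := exists_le_integral_studentT d hα0 hd
  obtain ⟨K, hK, hKb⟩ := exists_integral_studentTHat_le d hβ0 hβ1
  set e : ℝ := 1 / (1 - α) * α + 1 / (1 - β) * β with he
  have he0 : 0 < e := by
    have h1 : 0 < 1 - β := by linarith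
    have h2 : 0 < α - 1 := by linarith
    have : e = (2 * α * β - α - β) / ((α - 1) * (1 - β)) := by
      rw [he, ← neg_sub α 1]
      field_simp
      ring
    rw [this]
    exact div_pos (by linarith) (mul_pos h2 h1)
  have h2 : Tendsto (fun ν => 1 / (1 - α) * Real.log k + 1 / (1 - β) * Real.log K +
      e * Real.log ν) (𝓝[>] 0) atBot :=
    tendsto_atBot_add_const_left _ _ (Real.tendsto_log_nhdsGT_zero.const_mul_atBot he0)
  refine tendsto_atBot_mono' _ ?_ h2
  filter_upwards [self_mem_nhdsWithin, Ioo_mem_nhdsGT hd] with ν hν hν'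
  have hν : 0 < ν := hν
  have hαν : d < α * (d + ν) := by nlinarith
  have hβν : β * (d - ν) < d := by nlinarith [mul_pos hβ0 hν]
  have hνα : 0 < ν ^ α := Real.rpow_pos_of_pos hν _
  have hνβ : 0 < ν ^ β := Real.rpow_pos_of_pos hν _
  have hJ := integral_norm_studentTHat_rpow_pos (d := d) (p := 2 * β) hν (by positivity)
    (by linarith)
  have b1 : renyiEntropy α (studentT d ν) ≤
      1 / (1 - α) * (Real.log k + α * Real.log ν) := by
    rw [renyiEntropy_studentT hα0 hα1.ne' hν hαν, ← Real.log_rpow hν,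
      ← Real.log_mul hk.ne' hνα.ne']
    exact mul_le_mul_of_nonpos_left (Real.log_le_log (by positivity) (hkb ν hν hν'.2.le hαν))
      (one_div_nonpos.2 (by linarith))
  have b2 : renyiEntropy β (studentTHat d ν) ≤
      1 / (1 - β) * (Real.log K + β * Real.log ν) := by
    rw [renyiEntropy_studentTHat hβ0 hβ1.ne hν hβν, ← Real.log_rpow hν,
      ← Real.log_mul hK.ne' hνβ.ne']
    exact mul_le_mul_of_nonneg_left (Real.log_le_log hJ (hKb ν hν hν'.2.le))
      (one_div_nonneg.2 (by linarith))
  calc _ ≤ 1 / (1 - α) * (Real.log k + α * Real.log ν) +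
        1 / (1 - β) * (Real.log K + β * Real.log ν) := add_le_add b1 b2
    _ = _ := by rw [he]; ring

/-- Beyond the momentum threshold `d (β - 1) / β`, the position density to the power `α` is
integrable. -/
lemma lt_mul_add_of_mem_domainD0 {d : ℕ} [NeZero d] {α β ν : ℝ} (h : (α, β) ∈ domainD0)
    (hν : d * (β - 1) / β ≤ ν) : d < α * (d + ν) := by
  have hd : (0 : ℝ) < d := Nat.cast_pos.2 (NeZero.pos d)
  obtain ⟨hα2, hαβ⟩ := mem_domainD0_iff.1 h
  have hα0 : 0 < α := by linarith
  have hβ0 : 0 < β := by nlinarith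
  rw [div_le_iff₀ hβ0] at hν
  refine lt_of_mul_lt_mul_left ?_ hβ0.le
  have h1 : α * (d * (β - 1)) ≤ α * (ν * β) := by gcongr
  have h2 : d * (α + β) < d * (2 * α * β) := by gcongr
  linarith

lemma tendsto_renyiEntropy_add_atBot (d : ℕ) [NeZero d] {α β : ℝ} (h : (α, β) ∈ domainD0) :
    Tendsto (fun ν => renyiEntropy α (studentT d ν) + renyiEntropy β (studentTHat d ν))
      (𝓝[>] (max 0 (d * (β - 1) / β))) atBot := by
  have hd : (0 : ℝ) < d := Nat.cast_pos.2 (NeZero.pos d)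
  obtain ⟨hα2, hαβ⟩ := mem_domainD0_iff.1 h
  have hα0 : 0 < α := by linarith
  have hβ0 : 0 < β := by nlinarith
  rcases lt_trichotomy β 1 with h1 | rfl | h1
  · rw [max_eq_left (div_nonpos_of_nonpos_of_nonneg
      (mul_nonpos_of_nonneg_of_nonpos hd.le (by linarith)) hβ0.le)]
    exact tendsto_renyiEntropy_add_atBot_of_lt_one d h h1
  · rw [sub_self, mul_zero, zero_div, max_self]
    -- the domain is open, so a slightly smaller order may replace the Shannon entropy
    have hq : α / (2 * α - 1) < 1 := h.2
    obtain ⟨b, hb, hb1⟩ := exists_between hq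
    have hb0 : 0 < b := lt_trans (div_pos hα0 (by linarith)) hb
    refine tendsto_atBot_mono' _ ?_
      (tendsto_renyiEntropy_add_atBot_of_lt_one d (α := α) (β := b) ⟨hα2, hb⟩ hb1)
    filter_upwards [self_mem_nhdsWithin] with ν hν
    gcongr
    exact renyiEntropy_one_studentTHat_le hb0 hb1 hν
  · have hν₀0 : 0 < d * (β - 1) / β := div_pos (mul_pos hd (by linarith)) hβ0
    rw [max_eq_right hν₀0.le]
    obtain ⟨B, hB⟩ := exists_renyiEntropy_studentT_le d (M := d * (β - 1) / β + 1) hα0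
      (by positivity) hν₀0 (lt_mul_add_of_mem_domainD0 h le_rfl)
    refine tendsto_atBot_add_left_of_ge' _ B ?_ (tendsto_renyiEntropy_studentTHat_atBot d h1)
    filter_upwards [Ioo_mem_nhdsGT (lt_add_one (d * (β - 1) / β))] with ν hν
    exact hB ν hν.1.le hν.2.le

lemma tendsto_entropyPower_mul (d : ℕ) [NeZero d] {α β : ℝ} (h : (α, β) ∈ domainD0) :
    Tendsto
      (fun ν => entropyPower α (studentT d ν) * entropyPower β (waveFourier (studentT d ν)))
      (𝓝[>] (max 0 (d * (β - 1) / β))) (𝓝 0) := by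
  have hd : (0 : ℝ) < d := Nat.cast_pos.2 (NeZero.pos d)
  have h1 := Real.tendsto_exp_atBot.comp
    ((tendsto_renyiEntropy_add_atBot d h).const_mul_atBot (one_div_pos.2 hd))
  refine h1.congr' ?_
  filter_upwards [self_mem_nhdsWithin] with ν hν
  have hν : max 0 (d * (β - 1) / β) < ν := hν
  have hν0 : 0 < ν := (le_max_left _ _).trans_lt hν
  simp only [Function.comp_apply, entropyPower]
  rw [renyiEntropy_congr (waveFourier_studentT hν0), mul_add, Real.exp_add]

lemma hasRenyiEntropy_studentT_and_waveFourier {d : ℕ} [NeZero d] {α β ν : ℝ}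
    (h : (α, β) ∈ domainD0) (hν : max 0 (d * (β - 1) / β) < ν) :
    HasRenyiEntropy α (studentT d ν) ∧ HasRenyiEntropy β (waveFourier (studentT d ν)) := by
  obtain ⟨hα2, hαβ⟩ := mem_domainD0_iff.1 h
  have hα0 : 0 < α := by linarith
  have hβ0 : 0 < β := by nlinarith
  obtain ⟨hν0, hν1⟩ := max_lt_iff.1 hν
  refine ⟨hasRenyiEntropy_studentT hα0 hν0 (lt_mul_add_of_mem_domainD0 h hν1.le), ?_⟩
  rw [hasRenyiEntropy_congr (waveFourier_studentT hν0)]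
  rw [div_lt_iff₀ hβ0] at hν1
  exact hasRenyiEntropy_studentTHat hβ0 hν0 (by linarith)

end RenyiUncertainty

end

theorem theorem2 (d : ℕ) (hd : 1 ≤ d) :
    -- the Student-t functions are normalized wavefunctions, with the stated Fourier transform
    (∀ ν : ℝ, 0 < ν → IsWavefunction (studentT d ν) ∧
      waveFourier (studentT d ν) =ᵐ[volume] studentTHat d ν) ∧
    ∀ α β : ℝ, (α, β) ∈ domainD0 →
      -- the product of the entropy powers can be made arbitrarily small
      (∀ ε : ℝ, 0 < ε → ∃ ψ : Space d → ℂ, IsWavefunction ψ ∧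
        HasRenyiEntropy α ψ ∧ HasRenyiEntropy β (waveFourier ψ) ∧
        0 < entropyPower α ψ * entropyPower β (waveFourier ψ) ∧
        entropyPower α ψ * entropyPower β (waveFourier ψ) < ε) ∧
      -- no entropic uncertainty relation holds
      (¬ ∃ C : ℝ, 0 < C ∧ ∀ ψ : Space d → ℂ, IsWavefunction ψ →
        HasRenyiEntropy α ψ → HasRenyiEntropy β (waveFourier ψ) →
        C ≤ entropyPower α ψ * entropyPower β (waveFourier ψ)) ∧
      -- both entropies of the Student-t functions exist for `ν > max (0, d(β-1)/β)`
      (∀ ν : ℝ, max 0 (d * (β - 1) / β) < ν →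
        HasRenyiEntropy α (studentT d ν) ∧ HasRenyiEntropy β (waveFourier (studentT d ν))) ∧
      -- the Student-t functions are witnesses
      (∀ ε : ℝ, 0 < ε → ∃ ν : ℝ, max 0 (d * (β - 1) / β) < ν ∧
        entropyPower α (studentT d ν) * entropyPower β (waveFourier (studentT d ν)) < ε) ∧
      (1 < β → Tendsto
        (fun ν : ℝ => entropyPower α (studentT d ν) * entropyPower β (waveFourier (studentT d ν)))
        (𝓝[>] (d * (β - 1) / β)) (𝓝 0)) ∧
      (β < 1 → Tendsto
        (fun ν : ℝ => entropyPower α (studentT d ν) * entropyPower β (waveFourier (studentT d ν)))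
        (𝓝[>] 0) (𝓝 0)) := by
  have : NeZero d := ⟨by omega⟩
  refine ⟨fun ν hν => ⟨isWavefunction_studentT hν, waveFourier_studentT hν⟩, fun α β h => ?_⟩
  have hd0 : (0 : ℝ) < d := Nat.cast_pos.2 hd
  have hT := tendsto_entropyPower_mul d h
  have hE : ∀ ν : ℝ, max 0 (d * (β - 1) / β) < ν →
      HasRenyiEntropy α (studentT d ν) ∧ HasRenyiEntropy β (waveFourier (studentT d ν)) :=
    fun ν hν => hasRenyiEntropy_studentT_and_waveFourier h hν
  have hW : ∀ ε : ℝ, 0 < ε → ∃ ν : ℝ, max 0 (d * (β - 1) / β) < ν ∧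
      entropyPower α (studentT d ν) * entropyPower β (waveFourier (studentT d ν)) < ε := by
    intro ε hε
    obtain ⟨ν, hν, hlt⟩ := (eventually_mem_nhdsWithin.and (hT.eventually_lt_const hε)).exists
    exact ⟨ν, hν, hlt⟩
  refine ⟨fun ε hε => ?_, ?_, hE, hW, fun hβ => ?_, fun hβ => ?_⟩
  · obtain ⟨ν, hν, hlt⟩ := hW ε hε
    exact ⟨studentT d ν, isWavefunction_studentT ((le_max_left _ _).trans_lt hν), (hE ν hν).1,
      (hE ν hν).2, mul_pos (Real.exp_pos _) (Real.exp_pos _), hlt⟩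
  · rintro ⟨C, hC, hle⟩
    obtain ⟨ν, hν, hlt⟩ := hW C hC
    exact hlt.not_ge (hle _ (isWavefunction_studentT ((le_max_left _ _).trans_lt hν))
      (hE ν hν).1 (hE ν hν).2)
  · rwa [max_eq_right (div_nonneg (mul_nonneg hd0.le (by linarith)) (by linarith))] at hT
  · obtain ⟨hα2, hαβ⟩ := mem_domainD0_iff.1 h
    have hβ0 : 0 < β := by nlinarith
    rwa [max_eq_left (div_nonpos_of_nonpos_of_nonneg
      (mul_nonpos_of_nonneg_of_nonpos hd0.le (by linarith)) hβ0.le)] at hT
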